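/- Let $d\ge 0$ and $n\ge 1$ be integers, and let $u:\mathbb{R}^d\to\mathbb{C}$ be a non-zero continuous function in $L^2(\mathbb{R}^d)$ that is positive definite, i.e. $\sum_{p,q\in E}\overline{c(p)}\,c(q)\,u(p-q)\ge 0$ for every finite $E\subset\mathbb{R}^d$ and every $c:\mathbb{R}^d\to\mathbb{C}$. Let $\widehat u(\xi)=\int_{\mathbb{R}^d}u(x)e^{-2\pi i x\cdot\xi}\,dx$ be its Fourier transform (in the $L^2$ sense), and assume $\widehat u\in L^1\cap L^\infty$. Put $k(x,y)=u(x-y)$; for a positive definite kernel $\ell$ let $H_\ell$ be its reproducing kernel Hilbert space. Let $\|h\|_{L^2(\widehat u)}=\big(\int_{\mathbb{R}^d}|h(\xi)|^2\widehat u(\xi)\,d\xi\big)^{1/2}$, let $(m_zh)(\xi)=e^{-2\pi i z^{\top}\xi}h(\xi)$ for $z\in\mathbb{C}^d$, let $P_m\subset\mathbb{C}[\xi_1,\dots,\xi_d]$ be the space of polynomials of total degree at most $m$, and let $$\mathcal{G}(u)=\{A\in \mathrm{GL}_d(\mathbb{R}) : \text{there is }\lambda>0\text{ with }\widehat u(A^{\top}\xi)\ge\lambda\,\widehat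 u(\xi)\text{ for a.e. }\xi\}.$$ Assume: (A) for every $a>0$, $u$ satisfies $(\mathrm{DC})_{n,a}$, that is, for every $\varepsilon>0$ there is $L_\varepsilon>0$ with $|\widehat u(\xi)|\le L_\varepsilon\,(1+|\xi|^{2n+d+\varepsilon})^{-1}e^{-4\pi a|\xi|}$ for a.e. $\xi$; (B) $\displaystyle\sup_{z\in\mathbb{C}^d}\ \limsup_{m\to\infty}\Big(\sup_{P\in P_m\setminus\{0\}}\frac{\|m_zP\|_{L^2(\widehat u)}}{\|P\|_{L^2(\widehat u)}}\Big)^{1/m}<\infty$; (C) the real linear span of $\mathcal{G}(u)$ is $\mathrm{M}_d(\mathbb{R})$. Let $U\subset\mathbb{R}^d$ be open and let $f:U\to\mathbb{R}^d$ be a map for which there is a holomorphic map $F:\mathbb{C}^d\to\mathbb{C}^d$ with $F|_U=f$. Then the following are equivalent: 1. there are $A\in\mathcal{G}(u)$ and $b\in\mathbb{R}^d$ with $f(x)=Ax+b$ for all $x\in U$; 2. the composition operator $C_f:H_k\to H_{k|_{U^2}}$, $C_fh=h\circ f$, with domain $\{h\in H_k : h\circ f\in H_{k|_{U^2}}\}$,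 is defined on the whole of $H_k$ and is bounded. -/

import Mathlib

open MeasureTheory Filter Topology
open scoped ENNReal ComplexOrder ComplexConjugate FourierTransform

noncomputable section

/-! ### Reproducing kernel Hilbert spaces of scalar positive definite kernels -/

/-- `k : X × X → ℂ` is positive definite: for every `c : X → ℂ` and every finite `s ⊆ X`,
`∑_{p, q ∈ s} conj (c p) c q k(p, q) ≥ 0` (in particular the sum is real). -/
def IsPosDefKernel {X : Type*} (k : X → X → ℂ) : Prop :=
  ∀ (c : X → ℂ) (s : Finset X), 0 ≤ ∑ p ∈ s, ∑ q ∈ s, conj (c p) * c q * k p q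

/-- A scalar kernel as an operator-valued kernel, `k(x, y)` acting on `ℂ` by multiplication. -/
def kernelMatrix {X : Type*} (k : X → X → ℂ) : Matrix X X (ℂ →L[ℂ] ℂ) :=
  Matrix.of fun x y => k x y • ContinuousLinearMap.id ℂ ℂ

theorem kernelMatrix_apply {X : Type*} (k : X → X → ℂ) (x y : X) (c : ℂ) :
    kernelMatrix k x y c = k x y * c := by
  simp [kernelMatrix]

theorem IsPosDefKernel.conj_symm {X : Type*} {k : X → X → ℂ} (hk : IsPosDefKernel k) (p q : X) :
    conj (k q p) = k p q := by
  classical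
  have hd : ∀ r, (k r r).im = 0 := fun r => by
    have h := hk (fun _ => 1) {r}
    simp only [Finset.sum_singleton, map_one, one_mul] at h
    exact ((Complex.nonneg_iff.1 h).2).symm
  by_cases hpq : p = q
  · subst hpq
    exact Complex.conj_eq_iff_im.2 (hd p)
  · have hqp : q ≠ p := fun h => hpq h.symm
    have h1 := (Complex.nonneg_iff.1 (hk (fun _ => 1) {p, q})).2
    have h2 := (Complex.nonneg_iff.1 (hk (fun r => if r = p then 1 else Complex.I) {p, q})).2
    simp [Finset.sum_pair hpq, hqp, hd] at h1 h2
    apply Complex.ext <;> simp <;> linarith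

theorem IsPosDefKernel.posSemidef {X : Type*} {k : X → X → ℂ} (hk : IsPosDefKernel k) :
    (kernelMatrix k).PosSemidef := by
  have key := (RKHS.posSemidef_tfae (𝕜 := ℂ) (V := ℂ) (K := kernelMatrix k)).out 0 2
  refine key.2 ⟨?_, fun w => ?_⟩
  · refine Matrix.IsHermitian.ext fun x y => ?_
    rw [ContinuousLinearMap.star_eq_adjoint]
    refine ContinuousLinearMap.ext fun c => ext_inner_left ℂ fun v => ?_
    rw [ContinuousLinearMap.adjoint_inner_right, kernelMatrix_apply, kernelMatrix_apply,
      ← hk.conj_symm x y]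
    simp [mul_comm, mul_left_comm]
  · have h := (Complex.nonneg_iff.1 (hk w w.support)).1
    refine h.trans_eq ?_
    rw [← Complex.conj_re, Finset.sum_comm]
    simp [Finsupp.sum, kernelMatrix, mul_comm, mul_left_comm]

theorem IsPosDefKernel.restrict {X : Type*} {k : X → X → ℂ} (hk : IsPosDefKernel k) (U : Set X) :
    IsPosDefKernel fun x y : U => k x y := by
  classical
  intro c s
  have h := hk (fun x => if hx : x ∈ U then c ⟨x, hx⟩ else 0)
    (s.map (Function.Embedding.subtype _))
  simpa using h

/-- The reproducing kernel Hilbert space `H_k` of a positive definite kernel `k`. -/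
def KernelSpace {X : Type*} (k : X → X → ℂ) (hk : IsPosDefKernel k) : Type _ :=
  haveI : Fact (kernelMatrix k).PosSemidef := ⟨hk.posSemidef⟩
  RKHS.OfKernel (kernelMatrix k)

namespace KernelSpace

variable {X : Type*} (k : X → X → ℂ) (hk : IsPosDefKernel k)

instance : NormedAddCommGroup (KernelSpace k hk) :=
  haveI : Fact (kernelMatrix k).PosSemidef := ⟨hk.posSemidef⟩
  inferInstanceAs (NormedAddCommGroup (RKHS.OfKernel (kernelMatrix k)))

instance : InnerProductSpace ℂ (KernelSpace k hk) :=
  haveI : Fact (kernelMatrix k).PosSemidef := ⟨hk.posSemidef⟩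
  inferInstanceAs (InnerProductSpace ℂ (RKHS.OfKernel (kernelMatrix k)))

instance : CompleteSpace (KernelSpace k hk) :=
  haveI : Fact (kernelMatrix k).PosSemidef := ⟨hk.posSemidef⟩
  inferInstanceAs (CompleteSpace (RKHS.OfKernel (kernelMatrix k)))

instance : RKHS ℂ (KernelSpace k hk) X ℂ :=
  haveI : Fact (kernelMatrix k).PosSemidef := ⟨hk.posSemidef⟩
  inferInstanceAs (RKHS ℂ (RKHS.OfKernel (kernelMatrix k)) X ℂ)

theorem kernel_eq : RKHS.kernel (KernelSpace k hk) = kernelMatrix k :=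
  haveI : Fact (kernelMatrix k).PosSemidef := ⟨hk.posSemidef⟩
  RKHS.OfKernel.kernel_ofKernel (K := kernelMatrix k)

/-- The function `k_x = k(·, x)` belongs to `H_k`, and `⟨k_x, h⟩ = h(x)` for `h` in `H_k`. -/
theorem exists_reproducing (x : X) : ∃ kx : KernelSpace k hk,
    (∀ y, kx y = k y x) ∧ ∀ h : KernelSpace k hk, inner ℂ kx h = h x := by
  refine ⟨RKHS.kerFun (KernelSpace k hk) x 1, fun y => ?_, fun h => ?_⟩
  · rw [RKHS.kerFun_apply, kernel_eq, kernelMatrix_apply, mul_one]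
  · rw [RKHS.kerFun_inner]
    simp

end KernelSpace

/-- The composition operator `C_f h = h ∘ f` from a space `H` of functions on `X` to a space `H'`
of functions on `Y`, with domain `{h ∈ H : h ∘ f ∈ H'}`. -/
def compositionOperator {X Y : Type*} (H H' : Type*)
    [NormedAddCommGroup H] [InnerProductSpace ℂ H] [RKHS ℂ H X ℂ]
    [NormedAddCommGroup H'] [InnerProductSpace ℂ H'] [RKHS ℂ H' Y ℂ]
    (f : Y → X) : H →ₗ.[ℂ] H' where
  domain :=
    { carrier := {h | ∃ g : H', ∀ y, g y = h (f y)}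
      zero_mem' := ⟨0, fun y => by simp⟩
      add_mem' := by
        rintro h₁ h₂ ⟨g₁, e₁⟩ ⟨g₂, e₂⟩
        exact ⟨g₁ + g₂, fun y => by simp [e₁, e₂]⟩
      smul_mem' := by
        rintro c h ⟨g, e⟩
        exact ⟨c • g, fun y => by simp [e]⟩ }
  toFun :=
    { toFun := fun h => Classical.choose h.2
      map_add' := fun h₁ h₂ => by
        ext y
        have e₁ := Classical.choose_spec h₁.2 y
        have e₂ := Classical.choose_spec h₂.2 y
        have e₃ := Classical.choose_spec (h₁ + h₂).2 y
        simp only [RKHS.coe_add, Pi.add_apply, Submodule.coe_add] at e₁ e₂ e₃ ⊢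
        rw [e₁, e₂]
        exact e₃
      map_smul' := fun c h => by
        ext y
        have e₁ := Classical.choose_spec h.2 y
        have e₃ := Classical.choose_spec (c • h).2 y
        simp only [RKHS.coe_smul, Pi.smul_apply, Submodule.coe_smul, RingHom.id_apply] at e₁ e₃ ⊢
        rw [e₁]
        exact e₃ }

theorem compositionOperator_apply {X Y : Type*} (H H' : Type*)
    [NormedAddCommGroup H] [InnerProductSpace ℂ H] [RKHS ℂ H X ℂ]
    [NormedAddCommGroup H'] [InnerProductSpace ℂ H'] [RKHS ℂ H' Y ℂ]
    (f : Y → X) (h : (compositionOperator H H' f).domain) (y : Y) :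
    (compositionOperator H H' f h) y = (h : H) (f y) :=
  Classical.choose_spec h.2 y

/-- The composition operator `C_f : H_k → H_{k|U²}` of `f : U → ℝᵈ`, for the kernel
`k(x, y) = u(x - y)`. -/
def kernelCompositionOperator {d : ℕ} (u : EuclideanSpace ℝ (Fin d) → ℂ)
    (hu_pos : IsPosDefKernel fun x y => u (x - y)) (U : Set (EuclideanSpace ℝ (Fin d)))
    (f : U → EuclideanSpace ℝ (Fin d)) :
    KernelSpace (fun x y => u (x - y)) hu_pos →ₗ.[ℂ]
      KernelSpace (fun x y : U => u (x - y)) (hu_pos.restrict U) :=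
  compositionOperator _ _ f

/-! ### The Fourier transform of `u` and the conditions on it -/

/-- The (Plancherel) Fourier transform `û` of `u ∈ L²(ℝᵈ)`, normalised as
`û(ξ) = ∫ u(x) exp(-2π i x·ξ) dx`. As an `L²` function it is determined up to null sets, and it
is used only through statements that do not depend on the representative. -/
def fourierL2 {d : ℕ} (u : EuclideanSpace ℝ (Fin d) → ℂ) (hu : MemLp u 2 volume) :
    EuclideanSpace ℝ (Fin d) → ℂ :=
  ⇑(𝓕 (hu.toLp u) : Lp ℂ 2 (volume : Measure (EuclideanSpace ℝ (Fin d))))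

/-- The decay condition `(DC)_{n,a}` in dimension `d`, for the function `w = û`. -/
def DecayCondition {d : ℕ} (w : EuclideanSpace ℝ (Fin d) → ℂ) (n : ℕ) (a : ℝ) : Prop :=
  ∀ ε : ℝ, 0 < ε → ∃ L : ℝ, 0 < L ∧ ∀ᵐ ξ : EuclideanSpace ℝ (Fin d),
    ‖w ξ‖ ≤ L * (1 + ‖ξ‖ ^ (2 * (n : ℝ) + (d : ℝ) + ε))⁻¹ * Real.exp (-4 * Real.pi * a * ‖ξ‖)

/-- The norm of `L²(w)`, `‖h‖ = (∫ |h(ξ)|² w(ξ) dξ)^{1/2} ∈ [0, ∞]`, for `w = û ≥ 0`. -/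
def weightedNorm {d : ℕ} (w : EuclideanSpace ℝ (Fin d) → ℂ)
    (h : EuclideanSpace ℝ (Fin d) → ℂ) : ℝ≥0∞ :=
  (∫⁻ ξ, ‖h ξ‖ₑ ^ 2 * ENNReal.ofReal (w ξ).re) ^ (1 / 2 : ℝ)

/-- The function `ξ ↦ P(ξ)` on `ℝᵈ` given by a polynomial with complex coefficients. -/
def polyFun {d : ℕ} (P : MvPolynomial (Fin d) ℂ) (ξ : EuclideanSpace ℝ (Fin d)) : ℂ :=
  MvPolynomial.eval (fun i => (ξ i : ℂ)) P

/-- The multiplication operator `(m_z h)(ξ) = exp(-2π i zᵀξ) h(ξ)`. -/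
def mulExp {d : ℕ} (z : EuclideanSpace ℂ (Fin d)) (h : EuclideanSpace ℝ (Fin d) → ℂ)
    (ξ : EuclideanSpace ℝ (Fin d)) : ℂ :=
  Complex.exp (-2 * Real.pi * Complex.I * ∑ i, z i * (ξ i : ℂ)) * h ξ

/-- `sup_{P ∈ P_n \ {0}} ‖m_z P‖ / ‖P‖` in `L²(w)`, with `P_n` the polynomials of total degree at
most `n`. -/
def polyGrowth {d : ℕ} (w : EuclideanSpace ℝ (Fin d) → ℂ) (z : EuclideanSpace ℂ (Fin d))
    (n : ℕ) : ℝ≥0∞ :=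
  ⨆ P : {P : MvPolynomial (Fin d) ℂ // P.totalDegree ≤ n ∧ P ≠ 0},
    weightedNorm w (mulExp z (polyFun P.1)) / weightedNorm w (polyFun P.1)

/-- `sup_z limsup_n (sup_{P ∈ P_n \ {0}} ‖m_z P‖ / ‖P‖)^{1/n} < ∞`. -/
def GrowthCondition {d : ℕ} (w : EuclideanSpace ℝ (Fin d) → ℂ) : Prop :=
  (⨆ z : EuclideanSpace ℂ (Fin d),
    limsup (fun n : ℕ => polyGrowth w z n ^ (1 / (n : ℝ))) atTop) < ⊤

/-- `𝒢(u)`, in terms of `w = û`: the invertible real matrices `A` such that, for some `lam > 0`,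
`w(Aᵀξ) ≥ lam * w(ξ)` for almost every `ξ`. The inequality is in `ℂ` with its partial order, that
is, between real numbers when `w` is real-valued. -/
def dilationSet {d : ℕ} (w : EuclideanSpace ℝ (Fin d) → ℂ) : Set (Matrix (Fin d) (Fin d) ℝ) :=
  {A | IsUnit A ∧ ∃ lam : ℝ, 0 < lam ∧ ∀ᵐ ξ : EuclideanSpace ℝ (Fin d),
    (lam : ℂ) * w ξ ≤ w (Matrix.toEuclideanLin A.transpose ξ)}

/-- The inclusion `ℝᵈ ⊆ ℂᵈ`. -/
def realToComplex {d : ℕ} (x : EuclideanSpace ℝ (Fin d)) : EuclideanSpace ℂ (Fin d) :=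
  WithLp.toLp 2 fun i => (x i : ℂ)

end

/-! ### Bounded operators prescribed on a total family -/

/-! Write `e_z(ξ) = exp(-2πi zᵀξ)` and `μ = û dξ`. Fourier inversion and positive definiteness give
`û ≥ 0`, and `∑ c_i k_{x_i}` has in `H_k` the norm of `∑ c_i e_{x_i}` in `L²(μ)`. The adjoint of
`C_f` sends `k_x` to `k_{f(x)}`, so condition 2 says that `e_x ↦ e_{f(x)}`, `x ∈ U`, extends to a
bounded operator `K` on `L²(μ)`. This is `ExpBounded`. For affine `f` with `A ∈ 𝒢(u)` it follows
from a change of variables.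

Conversely, (A) puts all `e_z P`, with `z` complex and `P` a polynomial, in `L²(μ)`. The identity
theorem gives `K e_z = e_{F(z)}` for all `z`, and repeated differentiation in direction `v` gives `K
(e_z (vᵀξ)^{m+1}) = e_{F(z)} (((DF_z v)ᵀξ)^{m+1} + lower degree)`. Suppose `DF_z v = λ v`. Let `p`
have least norm among the polynomials `(vᵀξ)^{m+1} + lower degree`. Then `K` sends `e_z p` to
`e_{F(z)} q`, where `q` has leading part `λ^{m+1} (vᵀξ)^{m+1}`, so `‖q‖ ≥ |λ|^{m+1} ‖p‖`. Removing
the two exponentials costs a factor `M^{m+1}` each by (B). Letting `m → ∞` gives `|λ| ≤ M²`,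
uniformly in `z` (`ExpBounded.norm_eigenvalue_le`).

Hence `tr DF_z` is bounded and, by Liouville, constant. The same holds for `A ∘ F` with `A ∈ 𝒢(u)`,
so every `tr(A DF_z)` is constant. By (C) these functionals determine `DF_z`, so `F` is affine
(`ExpBounded.exists_eq_affine`). Finally, characters are dense in `L²` of a finite measure, so
boundedness for an affine map means that the image of `μ` under `Aᵀ` is dominated by a multiple of
`μ`, which is `A ∈ 𝒢(u)` (`ExpBounded.mem_dilationSet`). -/

theorem exists_clm_of_linearCombination_bound_of_dense {ι H H' : Type*}
    [NormedAddCommGroup H] [InnerProductSpace ℂ H]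
    [NormedAddCommGroup H'] [InnerProductSpace ℂ H'] [CompleteSpace H']
    (x : ι → H) (y : ι → H')
    (hx : (Submodule.span ℂ (Set.range x)).topologicalClosure = ⊤) (C : ℝ)
    (h : ∀ c : ι →₀ ℂ,
      ‖Finsupp.linearCombination ℂ y c‖ ≤ C * ‖Finsupp.linearCombination ℂ x c‖) :
    ∃ T : H →L[ℂ] H', ∀ i, T (x i) = y i := by
  have hd : DenseRange (Finsupp.linearCombination ℂ x) := by
    rw [← Finsupp.range_linearCombination] at hx
    have := Submodule.dense_iff_topologicalClosure_eq_top.2 hx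
    rwa [LinearMap.coe_range] at this
  refine ⟨(Finsupp.linearCombination ℂ y).extendOfNorm (Finsupp.linearCombination ℂ x), fun i => ?_⟩
  have := LinearMap.extendOfNorm_eq hd ⟨C, h⟩ (Finsupp.single i 1)
  simpa using this

/-! ### Kernel functions and the adjoint of a composition operator. -/

namespace KernelSpace

variable {X : Type*} {k : X → X → ℂ} (hk : IsPosDefKernel k)

/-- The function `k(·, x)` as an element of `H_k`. -/
noncomputable def point (x : X) : KernelSpace k hk := (exists_reproducing k hk x).choose

theorem point_apply (x y : X) : point hk x y = k y x := (exists_reproducing k hk x).choose_spec.1 y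

theorem inner_point (x : X) (h : KernelSpace k hk) : inner ℂ (point hk x) h = h x :=
  (exists_reproducing k hk x).choose_spec.2 h

/-- By the reproducing property, a function orthogonal to all kernel functions vanishes at every
point. -/
theorem topologicalClosure_span_range_point :
    (Submodule.span ℂ (Set.range (point hk))).topologicalClosure = ⊤ := by
  rw [Submodule.topologicalClosure_eq_top_iff, Submodule.eq_bot_iff]
  intro h hh
  ext x
  rw [← inner_point hk]
  simpa using (Submodule.mem_orthogonal _ _).1 hh _ (Submodule.subset_span ⟨x, rfl⟩)

theorem norm_sq_linearCombination_point {ι : Type*} (x : ι → X) (c : ι →₀ ℂ) :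
    ((‖Finsupp.linearCombination ℂ (fun i => point hk (x i)) c‖ ^ 2 : ℝ) : ℂ) =
      ∑ p ∈ c.support, ∑ q ∈ c.support, conj (c p) * c q * k (x p) (x q) := by
  have := inner_self_eq_norm_sq_to_K (𝕜 := ℂ)
    (Finsupp.linearCombination ℂ (fun i => point hk (x i)) c)
  push_cast
  refine this.symm.trans ?_
  simp only [Finsupp.linearCombination_apply, Finsupp.sum, sum_inner, inner_sum, inner_smul_left,
    inner_smul_right, inner_point, point_apply]
  rw [Finset.sum_comm]
  refine Finset.sum_congr rfl fun p _ => ?_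
  rw [Finset.mul_sum]
  refine Finset.sum_congr rfl fun q _ => by ring

/-- `C_f` is everywhere defined and bounded iff `k'_y ↦ k_{f y}` extends to a bounded operator. -/
theorem compositionOperator_bounded_iff {Y : Type*} {k' : Y → Y → ℂ} (hk' : IsPosDefKernel k')
    (f : Y → X) :
    ((compositionOperator (KernelSpace k hk) (KernelSpace k' hk') f).domain = ⊤ ∧
      ∃ C : ℝ, ∀ h : (compositionOperator (KernelSpace k hk) (KernelSpace k' hk') f).domain,
        ‖compositionOperator (KernelSpace k hk) (KernelSpace k' hk') f h‖ ≤ C * ‖h‖) ↔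
    ∃ C : ℝ, ∀ c : Y →₀ ℂ, ‖Finsupp.linearCombination ℂ (fun y => point hk (f y)) c‖ ≤
      C * ‖Finsupp.linearCombination ℂ (point hk') c‖ := by
  constructor
  · rintro ⟨hdom, C, hC⟩
    let e : KernelSpace k hk →ₗ[ℂ]
        (compositionOperator (KernelSpace k hk) (KernelSpace k' hk') f).domain :=
      LinearMap.codRestrict _ LinearMap.id (fun h => by rw [hdom]; trivial)
    let T : KernelSpace k hk →L[ℂ] KernelSpace k' hk' :=
      LinearMap.mkContinuous
        ((compositionOperator (KernelSpace k hk) (KernelSpace k' hk') f).toFun ∘ₗ e) C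
        (fun h => hC (e h))
    have hT : ∀ h y, T h y = h (f y) := fun h y =>
      compositionOperator_apply _ _ f (e h) y
    -- `⟨T* k'_y, h⟩ = (T h)(y) = h(f y) = ⟨k_{f y}, h⟩`.
    have hadj : ∀ y, ContinuousLinearMap.adjoint T (point hk' y) = point hk (f y) := fun y => by
      refine ext_inner_right ℂ fun h => ?_
      rw [ContinuousLinearMap.adjoint_inner_left, inner_point, inner_point, hT]
    refine ⟨‖ContinuousLinearMap.adjoint T‖, fun c => ?_⟩
    have : Finsupp.linearCombination ℂ (fun y => point hk (f y)) c =
        ContinuousLinearMap.adjoint T (Finsupp.linearCombination ℂ (point hk') c) := by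
      simp [Finsupp.linearCombination_apply, Finsupp.sum, map_sum, hadj]
    rw [this]
    exact ContinuousLinearMap.le_opNorm _ _
  · rintro ⟨C, hC⟩
    obtain ⟨S, hS⟩ := exists_clm_of_linearCombination_bound_of_dense (point hk')
      (fun y => point hk (f y)) (topologicalClosure_span_range_point hk') C hC
    -- The adjoint of the extension is composition with `f`; in particular every `h ∘ f` lies in the
    -- target space.
    have key : ∀ h : KernelSpace k hk, ∀ y, ContinuousLinearMap.adjoint S h y = h (f y) := by
      intro h y
      rw [← inner_point hk', ContinuousLinearMap.adjoint_inner_right, hS, inner_point]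
    refine ⟨?_, ‖ContinuousLinearMap.adjoint S‖, fun h => ?_⟩
    · rw [Submodule.eq_top_iff']
      exact fun h => ⟨ContinuousLinearMap.adjoint S h, key h⟩
    · have : compositionOperator (KernelSpace k hk) (KernelSpace k' hk') f h =
          ContinuousLinearMap.adjoint S h := by
        ext y
        rw [compositionOperator_apply, key]
      rw [this]
      exact ContinuousLinearMap.le_opNorm _ _

end KernelSpace

/-! ### Exponential functions and their linear combinations -/

/-- The exponential `ξ ↦ exp(-2π i zᵀξ)` with frequency `z ∈ ℂᵈ`. -/
noncomputable def expFun {d : ℕ} (z : EuclideanSpace ℂ (Fin d)) (ξ : EuclideanSpace ℝ (Fin d)) : ℂ :=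
  Complex.exp (-2 * Real.pi * Complex.I * ∑ i, z i * (ξ i : ℂ))

/-- The linear combination of the exponentials with frequencies `x i`. -/
noncomputable def expSum {d : ℕ} {ι : Type*} (x : ι → EuclideanSpace ℂ (Fin d)) (c : ι →₀ ℂ)
    (ξ : EuclideanSpace ℝ (Fin d)) : ℂ :=
  ∑ i ∈ c.support, c i * expFun (x i) ξ

section Exp
variable {d : ℕ}

theorem expFun_realToComplex (x ξ : EuclideanSpace ℝ (Fin d)) :
    expFun (realToComplex x) ξ = Complex.exp ((inner ℝ ξ ((-2 * Real.pi) • x) : ℝ) * Complex.I) := by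
  rw [expFun]
  congr 1
  simp [realToComplex, PiLp.inner_apply, Finset.mul_sum, Finset.sum_mul]
  refine Finset.sum_congr rfl fun i _ => by ring

theorem norm_expFun_realToComplex (x ξ : EuclideanSpace ℝ (Fin d)) :
    ‖expFun (realToComplex x) ξ‖ = 1 := by
  rw [expFun_realToComplex, Complex.norm_exp_ofReal_mul_I]

theorem conj_expFun_mul (x y ξ : EuclideanSpace ℝ (Fin d)) :
    conj (expFun (realToComplex x) ξ) * expFun (realToComplex y) ξ =
      Complex.exp ((2 * Real.pi * inner ℝ ξ (x - y) : ℝ) * Complex.I) := by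
  rw [expFun_realToComplex, expFun_realToComplex, ← Complex.exp_conj, ← Complex.exp_add]
  congr 1
  simp only [map_mul, Complex.conj_ofReal, Complex.conj_I, inner_smul_right, inner_sub_right]
  push_cast
  ring

theorem continuous_expFun (z : EuclideanSpace ℂ (Fin d)) : Continuous (expFun z) := by
  unfold expFun
  fun_prop

theorem continuous_expSum {ι : Type*} (x : ι → EuclideanSpace ℂ (Fin d)) (c : ι →₀ ℂ) :
    Continuous (expSum x c) := by
  unfold expSum
  exact continuous_finsetSum _ fun i _ => continuous_const.mul (continuous_expFun _)

theorem memLp_expFun (ρ : Measure (EuclideanSpace ℝ (Fin d))) [IsFiniteMeasure ρ]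
    (x : EuclideanSpace ℝ (Fin d)) : MemLp (expFun (realToComplex x)) 2 ρ :=
  MemLp.of_bound (continuous_expFun _).aestronglyMeasurable 1
    (Eventually.of_forall fun ξ => (norm_expFun_realToComplex x ξ).le)

theorem memLp_expSum {ι : Type*} (ρ : Measure (EuclideanSpace ℝ (Fin d))) [IsFiniteMeasure ρ]
    (x : ι → EuclideanSpace ℝ (Fin d)) (c : ι →₀ ℂ) :
    MemLp (expSum (fun i => realToComplex (x i)) c) 2 ρ := by
  unfold expSum
  exact memLp_finsetSum _ fun i _ => (memLp_expFun ρ (x i)).const_mul _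

end Exp

/-! ### Density of the characters in `L²` of a finite measure -/

section Density
variable {E : Type*} [NormedAddCommGroup E] [InnerProductSpace ℝ E] [MeasurableSpace E]
  [BorelSpace E] [SecondCountableTopology E]

theorem integrable_mul_char {ρ : Measure E} {g : E → ℂ} (hg : Integrable g ρ) (t : E) :
    Integrable (fun ξ => Complex.exp ((inner ℝ ξ t : ℝ) * Complex.I) * g ξ) ρ := by
  refine hg.bdd_mul (c := 1) (by fun_prop) (Eventually.of_forall fun ξ => ?_)
  rw [Complex.norm_exp_ofReal_mul_I]

/-- The measures with densities `g⁺` and `g⁻` are finite and have the same characteristic function,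
hence coincide. So `g⁺ = g⁻` almost everywhere, and both vanish because one of them is zero at each
point. -/
theorem ae_eq_zero_of_integral_char_real [CompleteSpace E] (ρ : Measure E) (g : E → ℝ) (hg : Integrable g ρ)
    (h : ∀ t : E, ∫ ξ, Complex.exp ((inner ℝ ξ t : ℝ) * Complex.I) * (g ξ : ℂ) ∂ρ = 0) :
    g =ᵐ[ρ] 0 := by
  wlog hm : Measurable g generalizing g
  · have hm := hg.aestronglyMeasurable.aemeasurable
    refine hm.ae_eq_mk.trans (this (hm.mk g) (hg.congr hm.ae_eq_mk) (fun t => ?_) hm.measurable_mk)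
    rw [← h t]
    refine integral_congr_ae ?_
    filter_upwards [hm.ae_eq_mk] with ξ hξ
    rw [hξ]
  have hfin : ∀ f : E → ℝ, Integrable f ρ →
      IsFiniteMeasure (ρ.withDensity fun ξ => ENNReal.ofReal (f ξ)) := fun f hf =>
    isFiniteMeasure_withDensity_ofReal hf.2
  have := hfin g hg
  have := hfin (fun ξ => - g ξ) hg.neg
  have heq : ρ.withDensity (fun ξ => ENNReal.ofReal (g ξ)) =
      ρ.withDensity (fun ξ => ENNReal.ofReal (- g ξ)) := by
    refine Measure.ext_of_charFun (funext fun t => ?_)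
    rw [charFun_apply, charFun_apply, integral_withDensity_eq_integral_toReal_smul (by fun_prop)
      (by simp), integral_withDensity_eq_integral_toReal_smul (by fun_prop) (by simp), ← sub_eq_zero,
      ← integral_sub, ← h t]
    · refine integral_congr_ae (Eventually.of_forall fun ξ => ?_)
      simp only [Complex.real_smul, ENNReal.toReal_ofReal']
      rw [← sub_mul, mul_comm]
      congr 1
      norm_cast
      rcases le_total (g ξ) 0 with h0 | h0 <;> simp [h0]
    · have := integrable_mul_char (hg.pos_part.ofReal (𝕜 := ℂ)) t
      refine this.congr (Eventually.of_forall fun ξ => ?_)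
      simp [ENNReal.toReal_ofReal', mul_comm]
    · have := integrable_mul_char (hg.neg_part.ofReal (𝕜 := ℂ)) t
      refine this.congr (Eventually.of_forall fun ξ => ?_)
      simp [ENNReal.toReal_ofReal', mul_comm]
  rw [withDensity_eq_iff (by fun_prop) (by fun_prop) (by
    have := measure_ne_top (ρ.withDensity fun ξ => ENNReal.ofReal (g ξ)) Set.univ
    rwa [withDensity_apply _ MeasurableSet.univ, setLIntegral_univ] at this)] at heq
  filter_upwards [heq] with ξ hξ
  rcases le_total (g ξ) 0 with h0 | h0
  · rw [ENNReal.ofReal_of_nonpos h0, eq_comm, ENNReal.ofReal_eq_zero] at hξ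
    simp only [Pi.zero_apply]
    linarith
  · rw [ENNReal.ofReal_of_nonpos (neg_nonpos.2 h0), ENNReal.ofReal_eq_zero] at hξ
    simp only [Pi.zero_apply]
    linarith

/-- Conjugation and `t ↦ -t` show that the transform of `conj g` vanishes too, so the real case
applies to the real and imaginary parts. -/
theorem ae_eq_zero_of_integral_char [CompleteSpace E] (ρ : Measure E) (g : E → ℂ) (hg : Integrable g ρ)
    (h : ∀ t : E, ∫ ξ, Complex.exp ((inner ℝ ξ t : ℝ) * Complex.I) * g ξ ∂ρ = 0) :
    g =ᵐ[ρ] 0 := by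
  have hc : ∀ t : E, ∫ ξ, Complex.exp ((inner ℝ ξ t : ℝ) * Complex.I) * conj (g ξ) ∂ρ = 0 := by
    intro t
    have := congrArg conj (h (-t))
    rw [← integral_conj, map_zero] at this
    rw [← this]
    refine integral_congr_ae (Eventually.of_forall fun ξ => ?_)
    simp [← Complex.exp_conj]
  have hgc : Integrable (fun ξ => conj (g ξ)) ρ :=
    (LinearIsometryEquiv.integrable_comp_iff Complex.conjLIE).2 hg
  have hre := ae_eq_zero_of_integral_char_real ρ (fun ξ => (g ξ).re) hg.re (fun t => by
    have : ∀ ξ, Complex.exp ((inner ℝ ξ t : ℝ) * Complex.I) * ((g ξ).re : ℂ) =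
        (1 / 2 : ℂ) * (Complex.exp ((inner ℝ ξ t : ℝ) * Complex.I) * g ξ +
          Complex.exp ((inner ℝ ξ t : ℝ) * Complex.I) * conj (g ξ)) := fun ξ => by
      rw [Complex.re_eq_add_conj]; ring
    simp_rw [this]
    rw [integral_const_mul, integral_add (integrable_mul_char hg t) (integrable_mul_char hgc t),
      h, hc]
    simp)
  have him := ae_eq_zero_of_integral_char_real ρ (fun ξ => (g ξ).im) hg.im (fun t => by
    have : ∀ ξ, Complex.exp ((inner ℝ ξ t : ℝ) * Complex.I) * ((g ξ).im : ℂ) =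
        (1 / (2 * Complex.I) : ℂ) * (Complex.exp ((inner ℝ ξ t : ℝ) * Complex.I) * g ξ -
          Complex.exp ((inner ℝ ξ t : ℝ) * Complex.I) * conj (g ξ)) := fun ξ => by
      rw [Complex.im_eq_sub_conj]; ring
    simp_rw [this]
    rw [integral_const_mul, integral_sub (integrable_mul_char hg t) (integrable_mul_char hgc t),
      h, hc]
    simp)
  filter_upwards [hre, him] with ξ h1 h2
  exact Complex.ext h1 h2

end Density

section Approx
variable {d : ℕ}

/-- A function orthogonal to all characters is integrable, as `ρ` is finite, and its Fourier
transform against `ρ` is zero. -/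
theorem topologicalClosure_span_expFun (ρ : Measure (EuclideanSpace ℝ (Fin d))) [IsFiniteMeasure ρ] :
    (Submodule.span ℂ (Set.range fun x => (memLp_expFun ρ x).toLp)).topologicalClosure = ⊤ := by
  rw [Submodule.topologicalClosure_eq_top_iff, Submodule.eq_bot_iff]
  intro g hg
  have hgi : Integrable g ρ := (Lp.memLp g).integrable (by norm_num)
  rw [Lp.eq_zero_iff_ae_eq_zero]
  refine ae_eq_zero_of_integral_char ρ g hgi fun t => ?_
  have := (Submodule.mem_orthogonal _ _).1 hg _
    (Submodule.subset_span ⟨((2 * Real.pi)⁻¹ • t), rfl⟩)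
  rw [L2.inner_def] at this
  rw [← this]
  refine integral_congr_ae ?_
  filter_upwards [(memLp_expFun ρ ((2 * Real.pi)⁻¹ • t)).coeFn_toLp] with ξ hξ
  rw [hξ, expFun_realToComplex]
  have : (-2 * Real.pi) • (2 * Real.pi)⁻¹ • t = -t := by
    rw [smul_smul, ← neg_one_smul ℝ t]
    congr 1
    have := Real.pi_ne_zero
    field_simp
  simp only [this, inner_neg_right, RCLike.inner_apply, ← Complex.exp_conj]
  simp [mul_comm]

/-- Approximating the indicator of `S` in `L²(ρ)` approximates it in `L²(μ)` for every `μ ≤ ρ`. A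
single sequence therefore serves several measures at once, with `ρ` their sum. -/
theorem exists_expSum_tendsto (ρ : Measure (EuclideanSpace ℝ (Fin d))) [IsFiniteMeasure ρ]
    {S : Set (EuclideanSpace ℝ (Fin d))} (hS : MeasurableSet S) :
    ∃ c : ℕ → EuclideanSpace ℝ (Fin d) →₀ ℂ, ∀ μ ≤ ρ,
      Tendsto (fun n => eLpNorm (expSum realToComplex (c n)) 2 μ) atTop
        (𝓝 (μ S ^ (1 / 2 : ℝ))) := by
  have hmem : MemLp (S.indicator fun _ => (1 : ℂ)) 2 ρ := memLp_indicator_const 2 hS 1 (by simp)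
  have hcl : hmem.toLp ∈ closure
      (Submodule.span ℂ (Set.range fun x => (memLp_expFun ρ x).toLp) : Set (Lp ℂ 2 ρ)) := by
    rw [← Submodule.topologicalClosure_coe, topologicalClosure_span_expFun]
    trivial
  obtain ⟨s, hs, hlim⟩ := mem_closure_iff_seq_limit.1 hcl
  have : ∀ n, ∃ c : EuclideanSpace ℝ (Fin d) →₀ ℂ, s n =ᵐ[ρ] expSum realToComplex c := fun n => by
    obtain ⟨c, hc⟩ := (Finsupp.mem_span_range_iff_exists_finsupp).1 (hs n)
    refine ⟨c, ?_⟩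
    rw [← hc, Finsupp.sum]
    refine (Lp.coeFn_finsetSum _ _).trans ?_
    have h2 : ∀ᵐ ξ ∂ρ, ∀ x ∈ c.support, (c x • (memLp_expFun ρ x).toLp :) ξ =
        c x * expFun (realToComplex x) ξ := by
      refine (Finset.eventually_all c.support).2 fun x _ => ?_
      filter_upwards [Lp.coeFn_smul (c x) (memLp_expFun ρ x).toLp,
        (memLp_expFun ρ x).coeFn_toLp] with ξ h3 h4
      rw [h3, Pi.smul_apply, h4, smul_eq_mul]
    filter_upwards [h2] with ξ hξ
    rw [Finset.sum_apply, expSum]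
    exact Finset.sum_congr rfl hξ
  choose c hc using this
  refine ⟨c, fun μ hμ => ?_⟩
  have hnorm : eLpNorm (S.indicator fun _ => (1 : ℂ)) 2 μ = μ S ^ (1 / 2 : ℝ) := by
    rw [eLpNorm_indicator_const hS (by simp) (by simp)]
    simp
  rw [← hnorm]
  have hz : Tendsto (fun n => eLpNorm (expSum realToComplex (c n) - S.indicator fun _ => (1 : ℂ)) 2 μ)
      atTop (𝓝 0) := by
    have h1 := (Lp.tendsto_Lp_iff_tendsto_eLpNorm _ _ hmem).1 hlim
    refine tendsto_of_tendsto_of_tendsto_of_le_of_le tendsto_const_nhds h1 (fun n => zero_le)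
      fun n => ?_
    refine (eLpNorm_mono_measure _ hμ).trans (le_of_eq (eLpNorm_congr_ae ?_))
    filter_upwards [hc n] with ξ hξ
    simp [hξ]
  have : IsFiniteMeasure μ := isFiniteMeasure_of_le ρ hμ
  have h3 := ((Lp.tendsto_Lp_iff_tendsto_eLpNorm'' _ (fun n => memLp_expSum μ id (c n)) _
    (hmem.mono_measure hμ)).2 hz).enorm
  simp only [Lp.enorm_toLp] at h3
  exact h3

/-- Domination of measures can be tested on linear combinations of characters. -/
theorem measure_le_of_eLpNorm_expSum_le (μ ν : Measure (EuclideanSpace ℝ (Fin d)))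
    [IsFiniteMeasure μ] [IsFiniteMeasure ν] (C : ℝ≥0∞) (hC : C ≠ ⊤)
    (h : ∀ c : EuclideanSpace ℝ (Fin d) →₀ ℂ,
      eLpNorm (expSum realToComplex c) 2 ν ≤ C * eLpNorm (expSum realToComplex c) 2 μ) :
    ν ≤ C ^ 2 • μ := by
  refine Measure.le_iff.2 fun S hS => ?_
  obtain ⟨c, hc⟩ := exists_expSum_tendsto (μ + ν) hS
  have h1 := hc μ (Measure.le_add_right le_rfl)
  have h2 := hc ν (Measure.le_add_left le_rfl)
  have h3 := le_of_tendsto_of_tendsto' h2 (ENNReal.Tendsto.const_mul h1 (Or.inr hC))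
    fun n => h (c n)
  have h4 := ENNReal.rpow_le_rpow h3 (zero_le_two (α := ℝ))
  rw [ENNReal.mul_rpow_of_nonneg _ _ zero_le_two, ← ENNReal.rpow_mul, ← ENNReal.rpow_mul] at h4
  simpa using h4

end Approx

/-! ### Fourier inversion and positivity of the spectral density -/

section Inversion
variable {d : ℕ}

theorem integral_fourierInv_mul {E : Type*} [NormedAddCommGroup E] [InnerProductSpace ℝ E]
    [FiniteDimensional ℝ E] [MeasurableSpace E] [BorelSpace E] {f g : E → ℂ}
    (hf : Integrable f) (hg : Integrable g) :
    ∫ x, 𝓕⁻ f x * g x = ∫ x, f x * 𝓕⁻ g x := by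
  have := VectorFourier.integral_fourierIntegral_smul_eq_flip (L := - innerₗ E) (μ := volume)
    (ν := volume) Real.continuous_fourierChar (by
      simp only [LinearMap.neg_apply, innerₗ_apply_apply]; fun_prop) hf hg
  simp only [smul_eq_mul] at this
  have hflip : (- innerₗ E).flip = - innerₗ E := by
    ext x y
    simp [real_inner_comm]
  rw [hflip] at this
  exact this

theorem continuous_fourierInv {E : Type*} [NormedAddCommGroup E] [InnerProductSpace ℝ E]
    [FiniteDimensional ℝ E] [MeasurableSpace E] [BorelSpace E] {f : E → ℂ}
    (hf : Integrable f) : Continuous (𝓕⁻ f) :=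
  VectorFourier.fourierIntegral_continuous (L := - innerₗ E) Real.continuous_fourierChar (by
      simp only [LinearMap.neg_apply, innerₗ_apply_apply]; fun_prop) hf

/-- Both sides are continuous, so it suffices that they agree as distributions. This follows from
inversion for tempered distributions and the multiplication formula `integral_fourierInv_mul`. -/
theorem eq_fourierInv_fourierL2 (u : EuclideanSpace ℝ (Fin d) → ℂ) (hu_cont : Continuous u)
    (hu : MemLp u 2 volume) (hu_L1 : MemLp (fourierL2 u hu) 1 volume) :
    u = 𝓕⁻ (fourierL2 u hu) := by
  have hw := memLp_one_iff_integrable.1 hu_L1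
  have hc := continuous_fourierInv hw
  refine Continuous.ae_eq_iff_eq volume hu_cont hc |>.1 ?_
  refine ae_eq_of_integral_contDiff_smul_eq hu_cont.locallyIntegrable hc.locallyIntegrable ?_
  intro g hg hgs
  have hgs' : HasCompactSupport (fun x => (g x : ℂ)) :=
    hgs.comp_left (g := fun r : ℝ => (r : ℂ)) (by simp)
  have hg' : ContDiff ℝ (⊤ : ℕ∞) (fun x => (g x : ℂ)) := Complex.ofRealCLM.contDiff.comp hg
  let φ : SchwartzMap (EuclideanSpace ℝ (Fin d)) ℂ := hgs'.toSchwartzMap hg'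
  have hφ : ∀ x, φ x = g x := fun x => rfl
  have h1 := congrArg (fun T => T φ)
    (Lp.fourierInv_toTemperedDistribution_eq (𝓕 (hu.toLp u) : Lp ℂ 2 volume))
  simp only [TemperedDistribution.fourierInv_apply, Lp.toTemperedDistribution_apply,
    FourierTransform.fourierInv_fourier_eq, SchwartzMap.fourierInv_coe, smul_eq_mul] at h1
  have h2 : ∫ x, φ x * hu.toLp u x = ∫ x, φ x * u x := by
    refine integral_congr_ae ?_
    filter_upwards [hu.coeFn_toLp] with x hx
    rw [hx]
  rw [h2] at h1
  have h3 := integral_fourierInv_mul φ.integrable hw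
  simp only [Complex.real_smul, ← hφ]
  rw [← h1, ← h3]
  rfl

theorem apply_sub_eq_integral (u : EuclideanSpace ℝ (Fin d) → ℂ) (hu_cont : Continuous u)
    (hu : MemLp u 2 volume) (hu_L1 : MemLp (fourierL2 u hu) 1 volume)
    (x y : EuclideanSpace ℝ (Fin d)) :
    u (x - y) = ∫ ξ, conj (expFun (realToComplex x) ξ) * expFun (realToComplex y) ξ *
      fourierL2 u hu ξ := by
  simp_rw [conj_expFun_mul]
  conv_lhs => rw [eq_fourierInv_fourierL2 u hu_cont hu hu_L1]
  rw [Real.fourierInv_eq']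
  rfl

/-- The source of the isometry between `H_k` and `L²(û)`: expand `|∑ c_i e_{x_i}|²` and apply
inversion to each term. -/
theorem sum_conj_mul_eq_integral (u : EuclideanSpace ℝ (Fin d) → ℂ) (hu_cont : Continuous u)
    (hu : MemLp u 2 volume) (hu_L1 : MemLp (fourierL2 u hu) 1 volume) {ι : Type*}
    (x : ι → EuclideanSpace ℝ (Fin d)) (c : ι →₀ ℂ) :
    ∑ p ∈ c.support, ∑ q ∈ c.support, conj (c p) * c q * u (x p - x q) =
      ∫ ξ, (‖expSum (fun i => realToComplex (x i)) c ξ‖ ^ 2 : ℝ) * fourierL2 u hu ξ := by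
  have hw := memLp_one_iff_integrable.1 hu_L1
  have hint : ∀ p q, Integrable (fun ξ => conj (c p) * c q *
      (conj (expFun (realToComplex (x p)) ξ) * expFun (realToComplex (x q)) ξ *
        fourierL2 u hu ξ)) := fun p q => by
    refine Integrable.const_mul (hw.bdd_mul (c := 1) ?_ (Eventually.of_forall fun ξ => ?_)) _
    · exact ((Complex.continuous_conj.comp (continuous_expFun _)).mul
        (continuous_expFun _)).aestronglyMeasurable
    · simp [norm_expFun_realToComplex]
  simp_rw [apply_sub_eq_integral u hu_cont hu hu_L1, ← integral_const_mul]
  simp_rw [← integral_finsetSum _ fun q _ => hint _ q]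
  rw [← integral_finsetSum _ fun p _ => integrable_finsetSum _ fun q _ => hint p q]
  refine integral_congr_ae (Eventually.of_forall fun ξ => ?_)
  have : ((‖expSum (fun i => realToComplex (x i)) c ξ‖ ^ 2 : ℝ) : ℂ) =
      conj (expSum (fun i => realToComplex (x i)) c ξ) *
        expSum (fun i => realToComplex (x i)) c ξ := by
    rw [Complex.conj_mul']; push_cast; rfl
  simp only [this]
  rw [expSum, map_sum, Finset.sum_mul_sum, Finset.sum_mul]
  refine Finset.sum_congr rfl fun p _ => ?_
  rw [Finset.sum_mul]
  refine Finset.sum_congr rfl fun q _ => ?_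
  rw [map_mul]
  ring

/-- A spectral density of a positive definite function is nonnegative. -/
theorem ae_nonneg_of_integral_nonneg (w : EuclideanSpace ℝ (Fin d) → ℂ) (hw : Integrable w)
    (hm : Measurable w)
    (h : ∀ c : EuclideanSpace ℝ (Fin d) →₀ ℂ,
      0 ≤ ∫ ξ, (‖expSum realToComplex c ξ‖ ^ 2 : ℝ) * w ξ) : ∀ᵐ ξ, 0 ≤ w ξ := by
  -- `ENNReal.ofReal` truncates, so `m f` has density `f⁺` and `m (-f)` has density `f⁻`.
  let m : (EuclideanSpace ℝ (Fin d) → ℝ) → Measure (EuclideanSpace ℝ (Fin d)) := fun f =>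
    volume.withDensity fun ξ => ENNReal.ofReal (f ξ)
  have hfin : ∀ f, Integrable f → IsFiniteMeasure (m f) := fun f hf =>
    isFiniteMeasure_withDensity_ofReal hf.2
  have hnorm : ∀ f, Integrable f → Measurable f → ∀ c,
      ((eLpNorm (expSum realToComplex c) 2 (m f)) ^ (2 : ℝ)).toReal =
        ∫ ξ, ‖expSum realToComplex c ξ‖ ^ 2 * max (f ξ) 0 := fun f hf hfm c => by
    have := hfin f hf
    rw [eLpNorm_eq_lintegral_rpow_enorm_toReal (by simp) (by simp), ← ENNReal.rpow_mul]
    simp only [ENNReal.toReal_ofNat, one_div, isUnit_iff_ne_zero, ne_eq, OfNat.ofNat_ne_zero,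
      not_false_eq_true, IsUnit.inv_mul_cancel, ENNReal.rpow_one]
    rw [lintegral_withDensity_eq_lintegral_mul _ (by fun_prop)
      ((continuous_expSum _ c).enorm.measurable.pow_const _),
      integral_eq_lintegral_of_nonneg_ae]
    · congr 1
      refine lintegral_congr fun ξ => ?_
      rw [Pi.mul_apply, ENNReal.ofReal_mul (by positivity), mul_comm]
      congr 1
      · rw [ENNReal.ofReal_pow (by positivity), ofReal_norm]
        norm_cast
      · simp [ENNReal.ofReal_max]
    · exact Eventually.of_forall fun ξ => by positivity
    · exact ((continuous_expSum _ c).norm.pow 2).aestronglyMeasurable.mul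
        (hfm.max measurable_const).aestronglyMeasurable
  -- The set `{f < 0}` is null for `m f`, hence for `m (-f)`, whose density is positive there.
  have hnn : ∀ f, Measurable f → (∀ S, MeasurableSet S → m (fun ξ => - f ξ) S ≤ m f S) →
      ∀ᵐ ξ, 0 ≤ f ξ := fun f hfm hle => by
    have hS : MeasurableSet {ξ | f ξ < 0} := measurableSet_lt hfm measurable_const
    have h1 : m f {ξ | f ξ < 0} = 0 := by
      rw [withDensity_apply _ hS]
      refine setLIntegral_eq_zero hS fun ξ hξ => ?_
      exact ENNReal.ofReal_of_nonpos (le_of_lt hξ)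
    have h2 := le_antisymm ((hle _ hS).trans h1.le) zero_le
    rw [withDensity_apply _ hS, setLIntegral_eq_zero_iff hS (by fun_prop)] at h2
    filter_upwards [h2] with ξ hξ
    by_contra! hneg
    have := hξ hneg
    rw [ENNReal.ofReal_eq_zero] at this
    linarith
  have hint : ∀ f : EuclideanSpace ℝ (Fin d) → ℝ, Integrable f → ∀ c,
      Integrable fun ξ => ‖expSum realToComplex c ξ‖ ^ 2 * f ξ := fun f hf c => by
    refine hf.bdd_mul (c := (∑ p ∈ c.support, ‖c p‖) ^ 2)
      ((continuous_expSum _ c).norm.pow 2).aestronglyMeasurable (Eventually.of_forall fun ξ => ?_)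
    rw [norm_pow, norm_norm]
    gcongr
    refine (norm_sum_le _ _).trans (Finset.sum_le_sum fun p _ => ?_)
    rw [norm_mul, norm_expFun_realToComplex, mul_one]
  let N : (EuclideanSpace ℝ (Fin d) → ℝ) → (EuclideanSpace ℝ (Fin d) →₀ ℂ) → ℝ := fun f c =>
    ((eLpNorm (expSum realToComplex c) 2 (m f)) ^ (2 : ℝ)).toReal
  have hN : ∀ f, Integrable f → Measurable f → ∀ c,
      N f c - N (fun ξ => - f ξ) c = ∫ ξ, ‖expSum realToComplex c ξ‖ ^ 2 * f ξ :=
    fun f hf hfm c => by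
    simp only [N]
    rw [hnorm f hf hfm, hnorm (fun ξ => - f ξ) hf.neg hfm.neg, ← integral_sub (hint _ hf.pos_part c)
      (hint _ hf.neg_part c)]
    refine integral_congr_ae (Eventually.of_forall fun ξ => ?_)
    simp only
    rw [← mul_sub, max_zero_sub_max_neg_zero_eq_self]
  have hwint : ∀ c, Integrable fun ξ => ((‖expSum realToComplex c ξ‖ ^ 2 : ℝ) : ℂ) * w ξ :=
    fun c => by
    refine ((hint _ hw.re c).ofReal (𝕜 := ℂ)).add
      (((hint _ hw.im c).ofReal (𝕜 := ℂ)).mul_const Complex.I) |>.congr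
        (Eventually.of_forall fun ξ => ?_)
    simp only [Pi.add_apply, Complex.coe_algebraMap, RCLike.re_to_complex, RCLike.im_to_complex]
    conv_rhs => rw [← Complex.re_add_im (w ξ)]
    push_cast
    ring
  have hre : Measurable fun ξ => (w ξ).re := Complex.measurable_re.comp hm
  have him : Measurable fun ξ => (w ξ).im := Complex.measurable_im.comp hm
  have hwre : Integrable fun ξ => (w ξ).re := hw.re
  have hwim : Integrable fun ξ => (w ξ).im := hw.im
  have hre_nonneg : ∀ c, N (fun ξ => - (w ξ).re) c ≤ N (fun ξ => (w ξ).re) c := fun c => by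
    rw [← sub_nonneg, hN _ hwre hre]
    refine (Complex.nonneg_iff.1 (h c)).1.trans_eq ?_
    refine (integral_re (hwint c)).symm.trans ?_
    simp only [RCLike.re_to_complex, Complex.re_ofReal_mul]
  have him_zero : ∀ c, N (fun ξ => - (w ξ).im) c = N (fun ξ => (w ξ).im) c := fun c => by
    rw [eq_comm, ← sub_eq_zero, hN _ hwim him]
    refine Eq.trans ?_ (Complex.nonneg_iff.1 (h c)).2.symm
    refine Eq.trans ?_ (integral_im (hwint c))
    simp only [RCLike.im_to_complex, Complex.im_ofReal_mul]
  have hlim : ∀ S, MeasurableSet S → m (fun ξ => - (w ξ).re) S ≤ m (fun ξ => (w ξ).re) S ∧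
      m (fun ξ => - (w ξ).im) S = m (fun ξ => (w ξ).im) S := fun S hS => by
    have := hfin _ hwre
    have := hfin _ hwre.neg
    have := hfin _ hwim
    have := hfin _ hwim.neg
    -- The same sums must converge for all four measures, since the hypothesis compares them sum by
    -- sum.
    obtain ⟨c, hc⟩ := exists_expSum_tendsto (m (fun ξ => (w ξ).re) + m (fun ξ => - (w ξ).re) +
      m (fun ξ => (w ξ).im) + m (fun ξ => - (w ξ).im)) hS
    have hNlim : ∀ f, IsFiniteMeasure (m f) → m f ≤ m (fun ξ => (w ξ).re) +
        m (fun ξ => - (w ξ).re) + m (fun ξ => (w ξ).im) + m (fun ξ => - (w ξ).im) →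
        Tendsto (fun n => N f (c n)) atTop (𝓝 (m f S).toReal) := fun f _ hf => by
      have h1 := (hc _ hf).ennrpow_const 2
      rw [← ENNReal.rpow_mul] at h1
      norm_num at h1
      simpa [N, Function.comp_def] using (ENNReal.tendsto_toReal (measure_ne_top (m f) S)).comp h1
    have l1 := hNlim _ (hfin _ hwre) (by
      rw [add_assoc, add_assoc]; exact Measure.le_add_right le_rfl)
    have l2 := hNlim _ (hfin _ hwre.neg) (by
      rw [add_assoc]; exact Measure.le_add_right (Measure.le_add_left le_rfl))
    have l3 := hNlim _ (hfin _ hwim) (Measure.le_add_right (Measure.le_add_left le_rfl))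
    have l4 := hNlim _ (hfin _ hwim.neg) (Measure.le_add_left le_rfl)
    refine ⟨?_, ?_⟩
    · rw [← ENNReal.toReal_le_toReal (measure_ne_top _ _) (measure_ne_top _ _)]
      exact le_of_tendsto_of_tendsto' l2 l1 fun n => hre_nonneg _
    · rw [← ENNReal.toReal_eq_toReal_iff' (measure_ne_top _ _) (measure_ne_top _ _)]
      exact tendsto_nhds_unique_of_eventuallyEq l4 l3 (Eventually.of_forall fun n => him_zero _)
  filter_upwards [hnn _ hre fun S hS => (hlim S hS).1, hnn _ him fun S hS => (hlim S hS).2.le,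
    hnn (fun ξ => - (w ξ).im) him.neg fun S hS => by simpa using (hlim S hS).2.ge] with ξ h1 h2 h3
  exact Complex.nonneg_iff.2 ⟨h1, le_antisymm h2 (by linarith)⟩

end Inversion

/-! ### Holomorphic functions of several variables -/

section Holomorphic
variable {V : Type*} [NormedAddCommGroup V] [NormedSpace ℂ V]

theorem hasDerivAt_comp_line {W : Type*} [NormedAddCommGroup W] [NormedSpace ℂ W] {G : V → W}
    (hG : Differentiable ℂ G) (z v : V) (t : ℂ) :
    HasDerivAt (fun s : ℂ => G (z + s • v)) (fderiv ℂ G (z + t • v) v) t := by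
  have h1 : HasDerivAt (fun s : ℂ => z + s • v) v t := by
    simpa using ((hasDerivAt_id t).smul_const v).const_add z
  exact (hG (z + t • v)).hasFDerivAt.comp_hasDerivAt t h1

/-- Cauchy's estimate on the unit circle of each complex line through `z`. -/
theorem norm_fderiv_le_of_norm_le {G : V → ℂ} (hG : Differentiable ℂ G) {z : V} {K : ℝ}
    (hK : ∀ y ∈ Metric.closedBall z 1, ‖G y‖ ≤ K) : ‖fderiv ℂ G z‖ ≤ K := by
  have hK0 : 0 ≤ K := (norm_nonneg _).trans (hK z (Metric.mem_closedBall_self zero_le_one))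
  refine ContinuousLinearMap.opNorm_le_of_unit_norm hK0 fun v hv => ?_
  have h1 := hasDerivAt_comp_line hG z v 0
  rw [zero_smul, add_zero] at h1
  rw [← h1.deriv, ← div_one K]
  have h2 : Differentiable ℂ fun s : ℂ => G (z + s • v) := fun s =>
    (hasDerivAt_comp_line hG z v s).differentiableAt
  refine Complex.norm_deriv_le_of_forall_mem_sphere_norm_le one_pos h2.diffContOnCl fun t ht => ?_
  refine hK _ ?_
  rw [mem_sphere_zero_iff_norm] at ht
  simp [norm_smul, ht, hv]

/-- Cauchy's formula writes the directional derivative as a circle integral of `G(z + t v)`, which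
can be differentiated under the integral sign. -/
theorem Differentiable.differentiable_fderiv_apply [FiniteDimensional ℂ V] {G : V → ℂ}
    (hG : Differentiable ℂ G) (v : V) : Differentiable ℂ fun z => fderiv ℂ G z v := by
  have : ProperSpace V := FiniteDimensional.proper ℂ V
  let _ : MeasurableSpace V := borel V
  have : BorelSpace V := ⟨rfl⟩
  have hcauchy : ∀ z, fderiv ℂ G z v =
      (2 * Real.pi * Complex.I : ℂ)⁻¹ • ∮ t in C(0, 1), (1 / (t - 0) ^ (1 + 1) : ℂ) • G (z + t • v) := by
    intro z
    have h1 := hasDerivAt_comp_line hG z v 0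
    rw [zero_smul, add_zero] at h1
    rw [← h1.deriv]
    have h2 : Differentiable ℂ fun s : ℂ => G (z + s • v) := fun s =>
      (hasDerivAt_comp_line hG z v s).differentiableAt
    have h3 := h2.diffContOnCl.circleIntegral_one_div_sub_center_pow_smul (c := 0) one_pos 1
    have h4 : (2 * Real.pi * Complex.I : ℂ) ≠ 0 := Complex.two_pi_I_ne_zero
    simp only [Nat.factorial_one, Nat.cast_one, div_one, iteratedDeriv_one] at h3
    rw [h3, smul_smul, inv_mul_cancel₀ h4, one_smul]
  simp_rw [hcauchy]
  refine Differentiable.fun_const_smul (fun z₀ => ?_) _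
  -- The radius allows 1 for `z` near `z₀`, `‖v‖` for the circle, and 1 for Cauchy's estimate.
  obtain ⟨K, hK⟩ := (isCompact_closedBall z₀ (2 + ‖v‖)).exists_bound_of_continuousOn
    hG.continuous.continuousOn
  have hbound : ∀ z ∈ Metric.ball z₀ 1, ∀ θ : ℝ, ‖fderiv ℂ G (z + circleMap 0 1 θ • v)‖ ≤ K := by
    intro z hz θ
    refine norm_fderiv_le_of_norm_le hG fun y hy => hK y ?_
    rw [Metric.mem_closedBall, dist_eq_norm] at hy ⊢
    rw [Metric.mem_ball, dist_eq_norm] at hz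
    have : y - z₀ = (y - (z + circleMap 0 1 θ • v)) + (z - z₀) + circleMap 0 1 θ • v := by abel
    rw [this]
    refine (norm_add₃_le).trans ?_
    rw [norm_smul, norm_circleMap_zero]
    norm_num
    linarith
  have hcirc : Continuous fun θ : ℝ => _root_.deriv (circleMap 0 1) θ := by
    simp only [deriv_circleMap]
    fun_prop
  have hinv : Continuous fun θ : ℝ => (1 / (circleMap 0 1 θ - 0) ^ (1 + 1) : ℂ) := by
    refine Continuous.div continuous_const (by fun_prop) fun θ => ?_
    simp
  unfold circleIntegral
  refine (intervalIntegral.hasFDerivAt_integral_of_dominated_of_fderiv_le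
    (F' := fun z θ => _root_.deriv (circleMap 0 1) θ • (1 / (circleMap 0 1 θ - 0) ^ (1 + 1) : ℂ) •
      fderiv ℂ G (z + circleMap 0 1 θ • v)) (bound := fun _ => K)
    (Metric.ball_mem_nhds z₀ one_pos) ?_ ?_ ?_ ?_ ?_ ?_).differentiableAt
  · refine Eventually.of_forall fun z => Continuous.aestronglyMeasurable ?_
    exact hcirc.smul (hinv.smul (hG.continuous.comp (by fun_prop)))
  · refine Continuous.intervalIntegrable ?_ _ _
    exact hcirc.smul (hinv.smul (hG.continuous.comp (by fun_prop)))
  · refine hcirc.aestronglyMeasurable.smul (hinv.aestronglyMeasurable.smul ?_)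
    refine ((measurable_fderiv ℂ G).stronglyMeasurable.comp_measurable ?_).aestronglyMeasurable
    exact Continuous.measurable (by fun_prop)
  · refine Eventually.of_forall fun θ _ z hz => ?_
    rw [norm_smul, norm_smul]
    simpa using hbound z hz θ
  · simp
  · refine Eventually.of_forall fun θ _ z hz => ?_
    have h1 : HasFDerivAt (fun z => G (z + circleMap 0 1 θ • v))
        (fderiv ℂ G (z + circleMap 0 1 θ • v)) z :=
      (hG (z + circleMap 0 1 θ • v)).hasFDerivAt.comp z ((hasFDerivAt_id z).add_const _)
    exact (h1.const_smul (1 / (circleMap 0 1 θ - 0) ^ (1 + 1) : ℂ)).const_smul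
      (_root_.deriv (circleMap 0 1) θ)

/-- An entire function on `ℂᵈ` vanishing on a nonempty open subset of `ℝᵈ` is zero. -/
theorem eq_zero_of_eqOn_real {d : ℕ} {G : EuclideanSpace ℂ (Fin d) → ℂ} (hG : Differentiable ℂ G)
    {U : Set (EuclideanSpace ℝ (Fin d))} (hU : IsOpen U) (hne : U.Nonempty)
    (h : ∀ x ∈ U, G (realToComplex x) = 0) : G = 0 := by
  have hline : ∀ z v : EuclideanSpace ℂ (Fin d),
      (∃ᶠ t in 𝓝[≠] (0 : ℂ), G (z + t • v) = 0) → ∀ t : ℂ, G (z + t • v) = 0 := by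
    intro z v hf t
    have hd : Differentiable ℂ fun s : ℂ => G (z + s • v) := fun s =>
      (hasDerivAt_comp_line hG z v s).differentiableAt
    have hA : AnalyticOnNhd ℂ (fun s : ℂ => G (z + s • v)) Set.univ :=
      hd.differentiableOn.analyticOnNhd isOpen_univ
    exact hA.eqOn_zero_of_preconnected_of_frequently_eq_zero isPreconnected_univ
      (Set.mem_univ _) hf (Set.mem_univ t)
  have hfreq : ∀ P : ℂ → Prop, (∀ᶠ t : ℝ in 𝓝 0, P t) → ∃ᶠ t in 𝓝[≠] (0 : ℂ), P t := by
    intro P hP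
    have h1 : Tendsto (fun t : ℝ => (t : ℂ)) (𝓝[≠] 0) (𝓝[≠] (0 : ℂ)) := by
      refine tendsto_nhdsWithin_iff.2 ⟨?_, ?_⟩
      · exact (Complex.continuous_ofReal.tendsto' 0 0 rfl).mono_left nhdsWithin_le_nhds
      · filter_upwards [self_mem_nhdsWithin] with t ht
        simpa using ht
    exact h1.frequently (hP.filter_mono nhdsWithin_le_nhds).frequently
  have hadd : ∀ (x v : EuclideanSpace ℝ (Fin d)) (t : ℝ),
      realToComplex x + (t : ℂ) • realToComplex v = realToComplex (x + t • v) := fun x v t => by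
    ext i; simp [realToComplex]
  obtain ⟨p, hp⟩ := hne
  -- The line from `p ∈ U` to `x` stays in `U` for small real parameters; evaluate at `t = 1`.
  have hreal : ∀ x : EuclideanSpace ℝ (Fin d), G (realToComplex x) = 0 := by
    intro x
    have h1 := hline (realToComplex p) (realToComplex (x - p)) (hfreq _ (by
      have : ∀ᶠ t : ℝ in 𝓝 0, p + t • (x - p) ∈ U := by
        have hc : Continuous fun t : ℝ => p + t • (x - p) := by fun_prop
        exact hc.continuousAt.eventually_mem (by simpa using hU.mem_nhds hp)
      filter_upwards [this] with t ht
      rw [hadd]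
      exact h _ ht)) ((1 : ℝ) : ℂ)
    rw [hadd] at h1
    simpa using h1
  funext z
  -- The line `Re z + t Im z` is real for real `t`; evaluate at `t = i`.
  have h2 := hline (realToComplex (WithLp.toLp 2 fun i => (z i).re))
    (realToComplex (WithLp.toLp 2 fun i => (z i).im)) (hfreq _ (Eventually.of_forall fun t => by
      rw [hadd]
      exact hreal _)) Complex.I
  rw [Pi.zero_apply, ← h2]
  congr 1
  ext i
  simp [realToComplex, mul_comm Complex.I, Complex.re_add_im]

end Holomorphic

/-! ### Exponential transforms of rapidly decaying functions -/

section Transform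
variable {d : ℕ}

/-- The linear form `z ↦ zᵀξ`. -/
noncomputable def dotForm (ξ : EuclideanSpace ℝ (Fin d)) : EuclideanSpace ℂ (Fin d) →L[ℂ] ℂ :=
  ∑ i, (ξ i : ℂ) • EuclideanSpace.proj i

theorem dotForm_apply (ξ : EuclideanSpace ℝ (Fin d)) (z : EuclideanSpace ℂ (Fin d)) :
    dotForm ξ z = ∑ i, z i * (ξ i : ℂ) := by
  simp [dotForm, mul_comm]

theorem norm_dotForm_le (ξ : EuclideanSpace ℝ (Fin d)) : ‖dotForm ξ‖ ≤ d * ‖ξ‖ := by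
  refine ContinuousLinearMap.opNorm_le_bound _ (by positivity) fun z => ?_
  rw [dotForm_apply]
  refine (norm_sum_le _ _).trans ((Finset.sum_le_card_nsmul _ _ (‖ξ‖ * ‖z‖) fun i _ => ?_).trans ?_)
  · rw [norm_mul, mul_comm, Complex.norm_real]
    exact mul_le_mul (PiLp.norm_apply_le _ _) (PiLp.norm_apply_le _ _) (norm_nonneg _) (norm_nonneg _)
  · simp [mul_assoc]

theorem continuous_dotForm : Continuous (dotForm (d := d)) := by
  unfold dotForm
  fun_prop

theorem expFun_eq (z : EuclideanSpace ℂ (Fin d)) (ξ : EuclideanSpace ℝ (Fin d)) :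
    expFun z ξ = Complex.exp (-2 * Real.pi * Complex.I * dotForm ξ z) := by
  rw [expFun, dotForm_apply]

theorem expFun_add (z z' : EuclideanSpace ℂ (Fin d)) (ξ : EuclideanSpace ℝ (Fin d)) :
    expFun (z + z') ξ = expFun z ξ * expFun z' ξ := by
  rw [expFun_eq, expFun_eq, expFun_eq, ← Complex.exp_add, map_add, mul_add]

theorem expFun_zero (ξ : EuclideanSpace ℝ (Fin d)) : expFun 0 ξ = 1 := by
  rw [expFun_eq, map_zero, mul_zero, Complex.exp_zero]

theorem norm_expFun_le (z : EuclideanSpace ℂ (Fin d)) (ξ : EuclideanSpace ℝ (Fin d)) :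
    ‖expFun z ξ‖ ≤ Real.exp (2 * Real.pi * d * ‖z‖ * ‖ξ‖) := by
  rw [expFun_eq]
  refine (Complex.norm_exp_le_exp_norm _).trans (Real.exp_le_exp.2 ?_)
  simp only [norm_mul, norm_neg, Complex.norm_ofNat, Complex.norm_real, Complex.norm_I,
    Real.norm_eq_abs, abs_of_pos Real.pi_pos, mul_one]
  have := (dotForm ξ).le_of_opNorm_le (norm_dotForm_le ξ) z
  calc 2 * Real.pi * ‖dotForm ξ z‖ ≤ 2 * Real.pi * (d * ‖ξ‖ * ‖z‖) := by gcongr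
    _ = _ := by ring

theorem continuous_polyFun (P : MvPolynomial (Fin d) ℂ) : Continuous (polyFun P) := by
  unfold polyFun
  exact (MvPolynomial.continuous_eval P).comp (by fun_prop)

theorem exists_norm_polyFun_le (P : MvPolynomial (Fin d) ℂ) :
    ∃ K k : ℝ, ∀ ξ : EuclideanSpace ℝ (Fin d), ‖polyFun P ξ‖ ≤ K * Real.exp (k * ‖ξ‖) := by
  suffices h : ∃ K k : ℝ, 0 ≤ K ∧ 0 ≤ k ∧ ∀ ξ : EuclideanSpace ℝ (Fin d),
      ‖polyFun P ξ‖ ≤ K * Real.exp (k * ‖ξ‖) by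
    obtain ⟨K, k, _, _, h⟩ := h
    exact ⟨K, k, h⟩
  induction P using MvPolynomial.induction_on with
  | C a => exact ⟨‖a‖, 0, norm_nonneg _, le_rfl, fun ξ => by simp [polyFun]⟩
  | add P Q hP hQ =>
    obtain ⟨K, k, hK, hk, h⟩ := hP
    obtain ⟨K', k', hK', hk', h'⟩ := hQ
    refine ⟨K + K', k + k', by positivity, by positivity, fun ξ => ?_⟩
    have e : polyFun (P + Q) ξ = polyFun P ξ + polyFun Q ξ := by simp [polyFun]
    rw [e, add_mul]
    refine (norm_add_le _ _).trans (add_le_add ((h ξ).trans ?_) ((h' ξ).trans ?_)) <;> gcongr <;>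
      linarith
  | mul_X P i hP =>
    obtain ⟨K, k, hK, hk, h⟩ := hP
    refine ⟨K, k + 1, hK, by positivity, fun ξ => ?_⟩
    have e : polyFun (P * MvPolynomial.X i) ξ = polyFun P ξ * ξ i := by simp [polyFun]
    rw [e, norm_mul, add_mul, Real.exp_add, ← mul_assoc]
    refine mul_le_mul (h ξ) ?_ (norm_nonneg _) (by positivity)
    rw [Complex.norm_real, one_mul]
    refine (PiLp.norm_apply_le ξ i).trans ?_
    linarith [Real.add_one_le_exp ‖ξ‖]

/-- `g` is integrable against every exponential `exp(c‖ξ‖)`. -/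
def ExpIntegrable (μ : Measure (EuclideanSpace ℝ (Fin d))) (g : EuclideanSpace ℝ (Fin d) → ℂ) :
    Prop :=
  ∀ c : ℝ, Integrable (fun ξ => (Real.exp (c * ‖ξ‖) : ℂ) * g ξ) μ

theorem ExpIntegrable.integrable {μ : Measure (EuclideanSpace ℝ (Fin d))}
    {g : EuclideanSpace ℝ (Fin d) → ℂ} (hg : ExpIntegrable μ g) : Integrable g μ := by
  simpa using hg 0

theorem ExpIntegrable.mul_of_le {μ : Measure (EuclideanSpace ℝ (Fin d))}
    {g h : EuclideanSpace ℝ (Fin d) → ℂ} (hg : ExpIntegrable μ g) (hh : Continuous h) {K k : ℝ}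
    (hle : ∀ ξ, ‖h ξ‖ ≤ K * Real.exp (k * ‖ξ‖)) : ExpIntegrable μ (fun ξ => g ξ * h ξ) := by
  intro c
  refine ((hg (c + k)).norm.const_mul K).mono' ?_ (Eventually.of_forall fun ξ => ?_)
  · exact (by fun_prop : Continuous fun ξ : EuclideanSpace ℝ (Fin d) =>
      (Real.exp (c * ‖ξ‖) : ℂ)).aestronglyMeasurable.mul
      (hg.integrable.aestronglyMeasurable.mul hh.aestronglyMeasurable)
  · simp only [norm_mul, Complex.norm_real, Real.norm_eq_abs, Real.abs_exp]
    rw [add_mul, Real.exp_add]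
    calc _ ≤ Real.exp (c * ‖ξ‖) * (‖g ξ‖ * (K * Real.exp (k * ‖ξ‖))) := by gcongr; exact hle ξ
      _ = _ := by ring

theorem ExpIntegrable.mul_polyFun {μ : Measure (EuclideanSpace ℝ (Fin d))}
    {g : EuclideanSpace ℝ (Fin d) → ℂ} (hg : ExpIntegrable μ g) (P : MvPolynomial (Fin d) ℂ) :
    ExpIntegrable μ (fun ξ => g ξ * polyFun P ξ) := by
  obtain ⟨K, k, h⟩ := exists_norm_polyFun_le P
  exact hg.mul_of_le (continuous_polyFun P) h

theorem ExpIntegrable.mul_expFun {μ : Measure (EuclideanSpace ℝ (Fin d))}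
    {g : EuclideanSpace ℝ (Fin d) → ℂ} (hg : ExpIntegrable μ g) (z : EuclideanSpace ℂ (Fin d)) :
    ExpIntegrable μ (fun ξ => g ξ * expFun z ξ) :=
  hg.mul_of_le (continuous_expFun z) (K := 1) fun ξ => by rw [one_mul]; exact norm_expFun_le z ξ

theorem ExpIntegrable.hasFDerivAt {μ : Measure (EuclideanSpace ℝ (Fin d))}
    {g : EuclideanSpace ℝ (Fin d) → ℂ} (hg : ExpIntegrable μ g) (z : EuclideanSpace ℂ (Fin d)) :
    ∃ L : EuclideanSpace ℂ (Fin d) →L[ℂ] ℂ,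
      HasFDerivAt (fun z => ∫ ξ, g ξ * expFun z ξ ∂μ) L z ∧
      ∀ v, L v = -2 * Real.pi * Complex.I * ∫ ξ, g ξ * (expFun z ξ * dotForm ξ v) ∂μ := by
  let F' : EuclideanSpace ℂ (Fin d) → EuclideanSpace ℝ (Fin d) → EuclideanSpace ℂ (Fin d) →L[ℂ] ℂ :=
    fun z ξ => (g ξ * expFun z ξ * (-2 * Real.pi * Complex.I)) • dotForm ξ
  -- This rate dominates all exponentials with frequency in the unit ball about `z`. The extra 1 in
  -- `k + 1` below absorbs the factor `‖ξ‖` of `dotForm`.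
  let k : ℝ := 2 * Real.pi * d * (‖z‖ + 1)
  let bound : EuclideanSpace ℝ (Fin d) → ℝ := fun ξ =>
    ‖(Real.exp ((k + 1) * ‖ξ‖) : ℂ) * g ξ‖ * (2 * Real.pi * d)
  have hmeas : AEStronglyMeasurable (F' z) μ :=
    ((hg.integrable.aestronglyMeasurable.mul (continuous_expFun z).aestronglyMeasurable).mul_const
      _).smul continuous_dotForm.aestronglyMeasurable
  have hbi : Integrable bound μ := (hg _).norm.mul_const _
  have hb : ∀ ξ, ∀ z' ∈ Metric.ball z 1, ‖F' z' ξ‖ ≤ bound ξ := by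
    intro ξ z' hz'
    have hz1 : ‖z'‖ ≤ ‖z‖ + 1 := by
      have := norm_sub_norm_le z' z
      rw [Metric.mem_ball, dist_eq_norm] at hz'
      linarith
    have h1 : ‖expFun z' ξ‖ ≤ Real.exp (k * ‖ξ‖) := (norm_expFun_le z' ξ).trans (by
      refine Real.exp_le_exp.2 ?_
      simp only [k]
      gcongr)
    have h2 : ‖dotForm ξ‖ ≤ d * Real.exp ‖ξ‖ := (norm_dotForm_le ξ).trans (by
      gcongr
      linarith [Real.add_one_le_exp ‖ξ‖])
    have h3 : ‖(-2 * Real.pi * Complex.I : ℂ)‖ = 2 * Real.pi := by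
      simp [abs_of_pos Real.pi_pos]
    simp only [F', bound]
    rw [norm_smul, norm_mul, norm_mul (g ξ), h3, norm_mul, Complex.norm_real, Real.norm_eq_abs,
      Real.abs_exp, add_mul, Real.exp_add, one_mul]
    calc _ ≤ ‖g ξ‖ * Real.exp (k * ‖ξ‖) * (2 * Real.pi) * (d * Real.exp ‖ξ‖) := by gcongr
      _ = _ := by ring
  refine ⟨∫ ξ, F' z ξ ∂μ, ?_, fun v => ?_⟩
  · refine hasFDerivAt_integral_of_dominated_of_fderiv_le (Metric.ball_mem_nhds z one_pos)
      (Eventually.of_forall fun z' => (hg.mul_expFun z').integrable.aestronglyMeasurable)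
      (hg.mul_expFun z).integrable hmeas (Eventually.of_forall hb) hbi
      (Eventually.of_forall fun ξ z' _ => ?_)
    simp only [expFun_eq, F']
    have := (((dotForm ξ).hasFDerivAt (x := z')).const_mul
      (-2 * Real.pi * Complex.I)).cexp.const_mul (g ξ)
    refine this.congr_fderiv ?_
    simp only [smul_smul]
    congr 1
    ring
  · rw [ContinuousLinearMap.integral_apply (hbi.mono' hmeas
      (Eventually.of_forall fun ξ => hb ξ z (Metric.mem_ball_self one_pos))), ← integral_const_mul]
    refine integral_congr_ae (Eventually.of_forall fun ξ => ?_)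
    simp only [F', smul_apply, smul_eq_mul]
    ring

/-- The polynomial `vᵀX`. -/
noncomputable def linPoly : EuclideanSpace ℂ (Fin d) →ₗ[ℂ] MvPolynomial (Fin d) ℂ where
  toFun v := ∑ i, v i • MvPolynomial.X i
  map_add' v v' := by simp [add_smul, Finset.sum_add_distrib]
  map_smul' c v := by simp [Finset.smul_sum, smul_smul]

theorem polyFun_add (P Q : MvPolynomial (Fin d) ℂ) (ξ : EuclideanSpace ℝ (Fin d)) :
    polyFun (P + Q) ξ = polyFun P ξ + polyFun Q ξ := by simp [polyFun]

theorem polyFun_mul (P Q : MvPolynomial (Fin d) ℂ) (ξ : EuclideanSpace ℝ (Fin d)) :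
    polyFun (P * Q) ξ = polyFun P ξ * polyFun Q ξ := by simp [polyFun]

theorem polyFun_smul (c : ℂ) (P : MvPolynomial (Fin d) ℂ) (ξ : EuclideanSpace ℝ (Fin d)) :
    polyFun (c • P) ξ = c * polyFun P ξ := by simp [polyFun, MvPolynomial.smul_eval]

theorem polyFun_linPoly (v : EuclideanSpace ℂ (Fin d)) (ξ : EuclideanSpace ℝ (Fin d)) :
    polyFun (linPoly v) ξ = dotForm ξ v := by
  simp [polyFun, linPoly, dotForm_apply, MvPolynomial.smul_eval]

theorem totalDegree_linPoly_le (v : EuclideanSpace ℂ (Fin d)) : (linPoly v).totalDegree ≤ 1 := by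
  refine MvPolynomial.totalDegree_finsetSum_le fun i _ => ?_
  exact (MvPolynomial.totalDegree_smul_le _ _).trans (MvPolynomial.totalDegree_X i).le

/-- The pairing `∫ g(ξ) exp(-2π i zᵀξ) P(ξ) dμ(ξ)`. -/
noncomputable def expPairing (μ : Measure (EuclideanSpace ℝ (Fin d)))
    (g : EuclideanSpace ℝ (Fin d) → ℂ) (z : EuclideanSpace ℂ (Fin d))
    (P : MvPolynomial (Fin d) ℂ) : ℂ :=
  ∫ ξ, g ξ * (expFun z ξ * polyFun P ξ) ∂μ

section Pairing
variable {μ : Measure (EuclideanSpace ℝ (Fin d))} {g : EuclideanSpace ℝ (Fin d) → ℂ}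

theorem ExpIntegrable.integrable_pairing (hg : ExpIntegrable μ g) (z : EuclideanSpace ℂ (Fin d))
    (P : MvPolynomial (Fin d) ℂ) : Integrable (fun ξ => g ξ * (expFun z ξ * polyFun P ξ)) μ := by
  simpa only [mul_assoc] using ((hg.mul_expFun z).mul_polyFun P).integrable

theorem expPairing_add (hg : ExpIntegrable μ g) (z : EuclideanSpace ℂ (Fin d))
    (P Q : MvPolynomial (Fin d) ℂ) :
    expPairing μ g z (P + Q) = expPairing μ g z P + expPairing μ g z Q := by
  simp only [expPairing, polyFun_add, mul_add]
  exact integral_add (hg.integrable_pairing z P) (hg.integrable_pairing z Q)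

theorem expPairing_smul (c : ℂ) (z : EuclideanSpace ℂ (Fin d)) (P : MvPolynomial (Fin d) ℂ) :
    expPairing μ g z (c • P) = c * expPairing μ g z P := by
  simp only [expPairing, polyFun_smul, ← integral_const_mul]
  refine integral_congr_ae (Eventually.of_forall fun ξ => ?_)
  simp only
  ring

/-- Differentiating in the frequency multiplies the polynomial by `-2πi vᵀξ`, so exponential
polynomials are preserved. -/
theorem ExpIntegrable.hasFDerivAt_expPairing (hg : ExpIntegrable μ g)
    (z : EuclideanSpace ℂ (Fin d)) (P : MvPolynomial (Fin d) ℂ) :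
    ∃ L : EuclideanSpace ℂ (Fin d) →L[ℂ] ℂ, HasFDerivAt (fun z => expPairing μ g z P) L z ∧
      ∀ v, L v = -2 * Real.pi * Complex.I * expPairing μ g z (linPoly v * P) := by
  obtain ⟨L, hL, hLv⟩ := (hg.mul_polyFun P).hasFDerivAt z
  refine ⟨L, ?_, fun v => ?_⟩
  · convert! hL using 4
    simp only [expPairing]
    refine integral_congr_ae (Eventually.of_forall fun ξ => ?_)
    simp only
    ring
  · rw [hLv, expPairing]
    congr 1
    refine integral_congr_ae (Eventually.of_forall fun ξ => ?_)
    simp only [polyFun_mul, polyFun_linPoly]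
    ring

end Pairing
end Transform

/-! ### Polynomials with entire coefficients -/

section HolPoly
variable {d : ℕ}

/-- Families of polynomials of degree at most `m` depending holomorphically on `z ∈ ℂᵈ`. -/
noncomputable def holPoly (d m : ℕ) : Submodule ℂ (EuclideanSpace ℂ (Fin d) → MvPolynomial (Fin d) ℂ) :=
  Submodule.span ℂ {R | ∃ r : EuclideanSpace ℂ (Fin d) → ℂ, ∃ Q : MvPolynomial (Fin d) ℂ,
    Differentiable ℂ r ∧ Q.totalDegree ≤ m ∧ R = fun z => r z • Q}

theorem smul_mem_holPoly {m : ℕ} {r : EuclideanSpace ℂ (Fin d) → ℂ} (hr : Differentiable ℂ r)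
    {Q : MvPolynomial (Fin d) ℂ} (hQ : Q.totalDegree ≤ m) : (fun z => r z • Q) ∈ holPoly d m :=
  Submodule.subset_span ⟨r, Q, hr, hQ, rfl⟩

theorem const_mem_holPoly {m : ℕ} {Q : MvPolynomial (Fin d) ℂ} (hQ : Q.totalDegree ≤ m) :
    (fun _ => Q) ∈ holPoly d m := by
  simpa using smul_mem_holPoly (differentiable_const (1 : ℂ)) hQ

theorem holPoly_mono {m m' : ℕ} (h : m ≤ m') : holPoly d m ≤ holPoly d m' := by
  refine Submodule.span_mono ?_
  rintro _ ⟨r, Q, hr, hQ, rfl⟩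
  exact ⟨r, Q, hr, hQ.trans h, rfl⟩

theorem totalDegree_le_of_mem_holPoly {m : ℕ}
    {R : EuclideanSpace ℂ (Fin d) → MvPolynomial (Fin d) ℂ} (hR : R ∈ holPoly d m)
    (z : EuclideanSpace ℂ (Fin d)) : (R z).totalDegree ≤ m := by
  induction hR using Submodule.span_induction with
  | mem R h =>
    obtain ⟨r, Q, hr, hQ, rfl⟩ := h
    exact (MvPolynomial.totalDegree_smul_le _ _).trans hQ
  | zero => simp
  | add R S _ _ hR hS =>
    exact (MvPolynomial.totalDegree_add _ _).trans (max_le hR hS)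
  | smul c R _ hR => exact (MvPolynomial.totalDegree_smul_le _ _).trans hR

theorem mul_mem_holPoly {m k : ℕ}
    {R S : EuclideanSpace ℂ (Fin d) → MvPolynomial (Fin d) ℂ} (hR : R ∈ holPoly d m)
    (hS : S ∈ holPoly d k) : R * S ∈ holPoly d (m + k) := by
  induction hR using Submodule.span_induction with
  | mem R h =>
    obtain ⟨r, Q, hr, hQ, rfl⟩ := h
    induction hS using Submodule.span_induction with
    | mem S h =>
      obtain ⟨s, P, hs, hP, rfl⟩ := h
      have : ((fun z => r z • Q) * fun z => s z • P) = fun z => (r z * s z) • (Q * P) := by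
        funext z
        simp [smul_smul, mul_comm]
      rw [this]
      exact smul_mem_holPoly (hr.mul hs)
        ((MvPolynomial.totalDegree_mul _ _).trans (add_le_add hQ hP))
    | zero => simp
    | add S S' _ _ hS hS' => rw [mul_add]; exact Submodule.add_mem _ hS hS'
    | smul c S _ hS => rw [mul_smul_comm]; exact Submodule.smul_mem _ _ hS
  | zero => simp
  | add R R' _ _ hR hR' => rw [add_mul]; exact Submodule.add_mem _ hR hR'
  | smul c R _ hR => rw [smul_mul_assoc]; exact Submodule.smul_mem _ _ hR

theorem pow_mem_holPoly {m : ℕ}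
    {R : EuclideanSpace ℂ (Fin d) → MvPolynomial (Fin d) ℂ} (hR : R ∈ holPoly d m) (k : ℕ) :
    R ^ k ∈ holPoly d (k * m) := by
  induction k with
  | zero =>
    rw [pow_zero]
    exact const_mem_holPoly (Q := 1) (by simp)
  | succ k ih =>
    rw [pow_succ, Nat.succ_mul]
    exact mul_mem_holPoly ih hR

theorem Differentiable.differentiable_fderiv_apply_euclidean
    {F : EuclideanSpace ℂ (Fin d) → EuclideanSpace ℂ (Fin d)} (hF : Differentiable ℂ F)
    (v : EuclideanSpace ℂ (Fin d)) : Differentiable ℂ fun z => fderiv ℂ F z v := by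
  refine differentiable_euclidean.2 fun i => ?_
  have hFi : Differentiable ℂ fun z => F z i := differentiable_euclidean.1 hF i
  have heq : (fun z => fderiv ℂ F z v i) = fun z => fderiv ℂ (fun z => F z i) z v := by
    funext z
    have h1 : HasFDerivAt (fun z => F z i)
        ((EuclideanSpace.proj i : EuclideanSpace ℂ (Fin d) →L[ℂ] ℂ).comp (fderiv ℂ F z)) z :=
      (EuclideanSpace.proj i : EuclideanSpace ℂ (Fin d) →L[ℂ] ℂ).hasFDerivAt.comp z
        (hF z).hasFDerivAt
    rw [h1.fderiv]
    rfl
  rw [heq]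
  exact hFi.differentiable_fderiv_apply v

theorem linPoly_mem_holPoly {G : EuclideanSpace ℂ (Fin d) → EuclideanSpace ℂ (Fin d)}
    (hG : Differentiable ℂ G) : (fun z => linPoly (G z)) ∈ holPoly d 1 := by
  have : (fun z => linPoly (G z)) = ∑ i, fun z => (G z i) • MvPolynomial.X i := by
    funext z
    simp [linPoly]
  rw [this]
  exact Submodule.sum_mem _ fun i _ => smul_mem_holPoly (differentiable_euclidean.1 hG i)
    (MvPolynomial.totalDegree_X i).le

/-- The derivative of a pairing along an entire map, in a fixed direction. -/
theorem exists_fderiv_expPairing_comp {m : ℕ}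
    {F : EuclideanSpace ℂ (Fin d) → EuclideanSpace ℂ (Fin d)} (hF : Differentiable ℂ F)
    {R : EuclideanSpace ℂ (Fin d) → MvPolynomial (Fin d) ℂ} (hR : R ∈ holPoly d m)
    (v : EuclideanSpace ℂ (Fin d)) (μ : Measure (EuclideanSpace ℝ (Fin d))) :
    ∃ R' ∈ holPoly d m, ∀ g, ExpIntegrable μ g → ∀ z,
      ∃ L : EuclideanSpace ℂ (Fin d) →L[ℂ] ℂ,
        HasFDerivAt (fun z => expPairing μ g (F z) (R z)) L z ∧
        L v = -2 * Real.pi * Complex.I *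
          expPairing μ g (F z) (linPoly (fderiv ℂ F z v) * R z + R' z) := by
  have hpi : (-2 * Real.pi * Complex.I : ℂ) ≠ 0 := by simp [Real.pi_ne_zero]
  induction hR using Submodule.span_induction with
  | mem R h =>
    obtain ⟨r, Q, hr, hQ, rfl⟩ := h
    -- The correction is the product-rule term in which the coefficient is differentiated, divided
    -- by the constant that the statement factors out.
    refine ⟨fun z => ((-2 * Real.pi * Complex.I)⁻¹ * fderiv ℂ r z v) • Q,
      smul_mem_holPoly ((hr.differentiable_fderiv_apply v).const_mul _) hQ, fun g hg z => ?_⟩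
    obtain ⟨L, hL, hLv⟩ := hg.hasFDerivAt_expPairing (F z) Q
    simp only [expPairing_smul]
    refine ⟨_, (hr z).hasFDerivAt.mul (hL.comp z (hF z).hasFDerivAt), ?_⟩
    rw [expPairing_add hg, mul_smul_comm, expPairing_smul, expPairing_smul]
    simp only [add_apply, smul_apply, ContinuousLinearMap.comp_apply, smul_eq_mul, hLv]
    generalize (-2 * Real.pi * Complex.I : ℂ) = K at hpi ⊢
    field_simp
  | zero =>
    refine ⟨0, Submodule.zero_mem _, fun g hg z => ⟨0, ?_, ?_⟩⟩
    · have : ∀ z, expPairing μ g (F z) 0 = 0 := fun z => by simp [expPairing, polyFun]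
      simp only [Pi.zero_apply, this]
      exact hasFDerivAt_const _ _
    · simp [expPairing, polyFun]
  | add R S _ _ hR hS =>
    obtain ⟨R', hR', h⟩ := hR
    obtain ⟨S', hS', h'⟩ := hS
    refine ⟨R' + S', Submodule.add_mem _ hR' hS', fun g hg z => ?_⟩
    obtain ⟨L, hL, hLv⟩ := h g hg z
    obtain ⟨L', hL', hLv'⟩ := h' g hg z
    refine ⟨L + L', ?_, ?_⟩
    · simp only [Pi.add_apply, expPairing_add hg]
      exact hL.add hL'
    · rw [add_apply, hLv, hLv', ← mul_add, ← expPairing_add hg]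
      simp only [Pi.add_apply]
      congr 2
      ring
  | smul c R _ hR =>
    obtain ⟨R', hR', h⟩ := hR
    refine ⟨c • R', Submodule.smul_mem _ _ hR', fun g hg z => ?_⟩
    obtain ⟨L, hL, hLv⟩ := h g hg z
    refine ⟨c • L, ?_, ?_⟩
    · simp only [Pi.smul_apply, expPairing_smul]
      exact hL.const_mul c
    · rw [smul_apply, hLv]
      simp only [Pi.smul_apply, mul_smul_comm, ← smul_add, expPairing_smul, smul_eq_mul]
      ring

/-! ### Intertwining relations obtained by continuation and differentiation. -/

/-- `exp(-2π i zᵀξ) P` is sent to `exp(-2π i F(z)ᵀξ) R(z)` by every bounded operator that sends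
the exponential of frequency `x` to that of frequency `F x`, for `x ∈ U`. -/
def Intertwines (μ : Measure (EuclideanSpace ℝ (Fin d))) (U : Set (EuclideanSpace ℝ (Fin d)))
    (F : EuclideanSpace ℂ (Fin d) → EuclideanSpace ℂ (Fin d)) (P : MvPolynomial (Fin d) ℂ)
    (R : EuclideanSpace ℂ (Fin d) → MvPolynomial (Fin d) ℂ) : Prop :=
  ∀ g₁ g₂, ExpIntegrable μ g₁ → ExpIntegrable μ g₂ →
    (∀ x ∈ U, expPairing μ g₁ (realToComplex x) 1 = expPairing μ g₂ (F (realToComplex x)) 1) →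
    ∀ z, expPairing μ g₁ z P = expPairing μ g₂ (F z) (R z)

variable {μ : Measure (EuclideanSpace ℝ (Fin d))} {U : Set (EuclideanSpace ℝ (Fin d))}
  {F : EuclideanSpace ℂ (Fin d) → EuclideanSpace ℂ (Fin d)}

/-- Both pairings are entire in `z` and agree on `U`, so the identity theorem applies. -/
theorem intertwines_one (hF : Differentiable ℂ F) (hU : IsOpen U) (hne : U.Nonempty) :
    Intertwines μ U F 1 fun _ => 1 := by
  intro g₁ g₂ hg₁ hg₂ h z
  have hd : Differentiable ℂ fun z => expPairing μ g₁ z 1 - expPairing μ g₂ (F z) 1 := fun z => by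
    obtain ⟨L, hL, -⟩ := hg₁.hasFDerivAt_expPairing z 1
    obtain ⟨L', hL', -⟩ := hg₂.hasFDerivAt_expPairing (F z) 1
    exact hL.differentiableAt.sub (hL'.comp z (hF z).hasFDerivAt).differentiableAt
  have := congrFun (eq_zero_of_eqOn_real hd hU hne fun x hx => sub_eq_zero.2 (h x hx)) z
  exact sub_eq_zero.1 this

theorem Intertwines.add {P Q : MvPolynomial (Fin d) ℂ}
    {R S : EuclideanSpace ℂ (Fin d) → MvPolynomial (Fin d) ℂ} (hP : Intertwines μ U F P R)
    (hQ : Intertwines μ U F Q S) : Intertwines μ U F (P + Q) fun z => R z + S z := by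
  intro g₁ g₂ hg₁ hg₂ h z
  rw [expPairing_add hg₁, expPairing_add hg₂, hP g₁ g₂ hg₁ hg₂ h, hQ g₁ g₂ hg₁ hg₂ h]

theorem Intertwines.smul {P : MvPolynomial (Fin d) ℂ}
    {R : EuclideanSpace ℂ (Fin d) → MvPolynomial (Fin d) ℂ} (hP : Intertwines μ U F P R)
    (c : ℂ) : Intertwines μ U F (c • P) fun z => c • R z := by
  intro g₁ g₂ hg₁ hg₂ h z
  rw [expPairing_smul, expPairing_smul, hP g₁ g₂ hg₁ hg₂ h]

/-- The relation holds for all `z`, so both sides may be differentiated in direction `v` and the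
constant `-2πi` cancelled. -/
theorem Intertwines.linPoly_mul (hF : Differentiable ℂ F) {m : ℕ} {P : MvPolynomial (Fin d) ℂ}
    {R : EuclideanSpace ℂ (Fin d) → MvPolynomial (Fin d) ℂ} (hR : R ∈ holPoly d m)
    (hP : Intertwines μ U F P R) (v : EuclideanSpace ℂ (Fin d)) :
    ∃ R' ∈ holPoly d m,
      Intertwines μ U F (linPoly v * P) fun z => linPoly (fderiv ℂ F z v) * R z + R' z := by
  obtain ⟨R', hR', h'⟩ := exists_fderiv_expPairing_comp hF hR v μ
  refine ⟨R', hR', fun g₁ g₂ hg₁ hg₂ h z => ?_⟩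
  have hpi : (-2 * Real.pi * Complex.I : ℂ) ≠ 0 := by simp [Real.pi_ne_zero]
  obtain ⟨L, hL, hLv⟩ := hg₁.hasFDerivAt_expPairing z P
  obtain ⟨L', hL', hLv'⟩ := h' g₂ hg₂ z
  have heq : (fun z => expPairing μ g₁ z P) = fun z => expPairing μ g₂ (F z) (R z) :=
    funext (hP g₁ g₂ hg₁ hg₂ h)
  rw [heq] at hL
  refine mul_left_cancel₀ hpi ?_
  rw [← hLv, ← hLv', hL.unique hL']

/-- Monomials are built one variable at a time by differentiating in coordinate directions, each
raising the degree on both sides by at most one. Linearity does the rest. -/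
theorem exists_intertwines (hF : Differentiable ℂ F) (hU : IsOpen U) (hne : U.Nonempty) (m : ℕ)
    (P : MvPolynomial (Fin d) ℂ) (hP : P.totalDegree ≤ m) :
    ∃ R ∈ holPoly d m, Intertwines μ U F P R := by
  have hmon : ∀ k : ℕ, ∀ s : Fin d →₀ ℕ, s.degree = k →
      ∃ R ∈ holPoly d k, Intertwines μ U F (MvPolynomial.monomial s 1) R := by
    intro k
    induction k with
    | zero =>
      intro s hs
      rw [Finsupp.degree_eq_zero_iff] at hs
      subst hs
      exact ⟨fun _ => 1, const_mem_holPoly (by simp), intertwines_one hF hU hne⟩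
    | succ k ih =>
      intro s hs
      obtain ⟨i, hi⟩ : ∃ i, s i ≠ 0 := by
        by_contra! hcon
        have : s = 0 := Finsupp.ext hcon
        rw [this] at hs
        simp at hs
      have hsi : Finsupp.single i 1 ≤ s := by
        rw [Finsupp.single_le_iff]
        omega
      have hsum : Finsupp.single i 1 + (s - Finsupp.single i 1) = s := add_tsub_cancel_of_le hsi
      obtain ⟨R, hR, hI⟩ := ih (s - Finsupp.single i 1) (by
        have := congrArg Finsupp.degree hsum
        rw [map_add, Finsupp.degree_single] at this
        omega)
      obtain ⟨R', hR', hI'⟩ := hI.linPoly_mul hF hR (EuclideanSpace.single i 1)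
      refine ⟨_, ?_, by
        have h1 : linPoly (EuclideanSpace.single i 1) *
            MvPolynomial.monomial (s - Finsupp.single i 1) (1 : ℂ) = MvPolynomial.monomial s 1 := by
          have : linPoly (EuclideanSpace.single i (1 : ℂ)) =
              MvPolynomial.monomial (Finsupp.single i 1) 1 := by
            simp [linPoly, MvPolynomial.X]
          rw [this, MvPolynomial.monomial_mul, hsum, one_mul]
        rw [← h1]
        exact hI'⟩
      refine Submodule.add_mem _ ?_ (holPoly_mono (Nat.le_succ k) hR')
      rw [add_comm]
      exact mul_mem_holPoly (linPoly_mem_holPoly (hF.differentiable_fderiv_apply_euclidean _)) hR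
  suffices hfin : ∀ t : Finset (Fin d →₀ ℕ), (∀ s ∈ t, s.degree ≤ m) →
      ∃ R ∈ holPoly d m, Intertwines μ U F (∑ s ∈ t, MvPolynomial.monomial s (P.coeff s)) R by
    have := hfin P.support fun s hs => ?_
    · rwa [MvPolynomial.support_sum_monomial_coeff] at this
    · exact (MvPolynomial.le_totalDegree hs).trans hP
  intro t
  induction t using Finset.cons_induction with
  | empty =>
    intro _
    refine ⟨0, Submodule.zero_mem _, fun g₁ g₂ _ _ _ z => ?_⟩
    simp [expPairing, polyFun]
  | cons s t hs ih =>
    intro ht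
    obtain ⟨R, hR, hI⟩ := ih fun s' hs' => ht s' (Finset.mem_cons_of_mem hs')
    obtain ⟨S, hS, hJ⟩ := hmon _ s rfl
    rw [Finset.sum_cons]
    have h2 : MvPolynomial.monomial s (P.coeff s) = P.coeff s • MvPolynomial.monomial s 1 := by
      rw [MvPolynomial.smul_monomial, smul_eq_mul, mul_one]
    rw [h2]
    exact ⟨_, Submodule.add_mem _ (Submodule.smul_mem _ _
      (holPoly_mono (ht s (Finset.mem_cons_self s t)) hS)) hR, (hJ.smul _).add hI⟩

/-- Only derivatives falling on the exponential raise the degree, and each contributes the factor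
`(DF_z v)ᵀξ`. So the top-degree part is known exactly and all else has degree at most `m`. -/
theorem exists_intertwines_linPoly_pow (hF : Differentiable ℂ F) (hU : IsOpen U)
    (hne : U.Nonempty) (v : EuclideanSpace ℂ (Fin d)) (m : ℕ) :
    ∃ R ∈ holPoly d m, Intertwines μ U F (linPoly v ^ (m + 1))
      fun z => linPoly (fderiv ℂ F z v) ^ (m + 1) + R z := by
  have hlin := linPoly_mem_holPoly (hF.differentiable_fderiv_apply_euclidean v)
  induction m with
  | zero =>
    obtain ⟨R', hR', hI⟩ := (intertwines_one (μ := μ) hF hU hne).linPoly_mul hF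
      (const_mem_holPoly (m := 0) (by simp)) v
    exact ⟨R', hR', by simpa using hI⟩
  | succ m ih =>
    obtain ⟨R, hR, hI⟩ := ih
    have hpow := pow_mem_holPoly hlin (m + 1)
    rw [mul_one] at hpow
    obtain ⟨R', hR', hI'⟩ := hI.linPoly_mul hF
      (Submodule.add_mem _ hpow (holPoly_mono (Nat.le_succ m) hR)) v
    refine ⟨_, Submodule.add_mem _ (by
      have := mul_mem_holPoly hlin hR
      rwa [add_comm] at this) hR', ?_⟩
    rw [pow_succ']
    convert! hI' using 2 with z
    simp only [Pi.add_apply, Pi.mul_apply, Pi.pow_apply]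
    ring

end HolPoly

/-! ### Exponential polynomials in `L²(μ)` -/

section ExpPoly
variable {d : ℕ} {μ : Measure (EuclideanSpace ℝ (Fin d))}

theorem ExpIntegrable.memLp_expFun_mul_polyFun (hμ : ExpIntegrable μ fun _ => 1)
    (z : EuclideanSpace ℂ (Fin d)) (P : MvPolynomial (Fin d) ℂ) :
    MemLp (fun ξ => expFun z ξ * polyFun P ξ) 2 μ := by
  have hc : Continuous fun ξ => expFun z ξ * polyFun P ξ :=
    (continuous_expFun z).mul (continuous_polyFun P)
  rw [memLp_two_iff_integrable_sq_norm hc.aestronglyMeasurable]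
  refine ((((hμ.mul_expFun z).mul_polyFun P).mul_expFun z).mul_polyFun P).integrable.norm.congr
    (Eventually.of_forall fun ξ => ?_)
  simp only [norm_mul, norm_one]
  ring

/-- Cauchy–Schwarz, since every `exp(c‖ξ‖)` is itself in `L²(μ)`. -/
theorem ExpIntegrable.of_memLp_two (hμ : ExpIntegrable μ fun _ => 1)
    {g : EuclideanSpace ℝ (Fin d) → ℂ} (hg : MemLp g 2 μ) : ExpIntegrable μ g := by
  intro c
  have hc : Continuous fun ξ : EuclideanSpace ℝ (Fin d) => (Real.exp (c * ‖ξ‖) : ℂ) := by fun_prop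
  have h1 : MemLp (fun ξ : EuclideanSpace ℝ (Fin d) => (Real.exp (c * ‖ξ‖) : ℂ)) 2 μ := by
    rw [memLp_two_iff_integrable_sq_norm hc.aestronglyMeasurable]
    refine (hμ (c + c)).norm.congr (Eventually.of_forall fun ξ => ?_)
    simp only [mul_one, Complex.norm_real, Real.norm_eq_abs, Real.abs_exp]
    rw [sq, ← Real.exp_add, add_mul]
  exact h1.integrable_mul hg

/-- The exponential polynomial `exp(-2π i zᵀξ) P(ξ)` as an element of `L²(μ)`, linearly in `P`. -/
noncomputable def expPoly (hμ : ExpIntegrable μ fun _ => 1) (z : EuclideanSpace ℂ (Fin d)) :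
    MvPolynomial (Fin d) ℂ →ₗ[ℂ] Lp ℂ 2 μ where
  toFun P := (hμ.memLp_expFun_mul_polyFun z P).toLp
  map_add' P Q := by
    rw [← MemLp.toLp_add]
    congr 1
    funext ξ
    simp [polyFun_add, mul_add]
  map_smul' c P := by
    rw [RingHom.id_apply, ← MemLp.toLp_const_smul]
    congr 1
    funext ξ
    simp only [polyFun_smul, Pi.smul_apply, smul_eq_mul]
    ring

theorem coeFn_expPoly (hμ : ExpIntegrable μ fun _ => 1) (z : EuclideanSpace ℂ (Fin d))
    (P : MvPolynomial (Fin d) ℂ) : expPoly hμ z P =ᵐ[μ] fun ξ => expFun z ξ * polyFun P ξ :=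
  (hμ.memLp_expFun_mul_polyFun z P).coeFn_toLp

theorem norm_expPoly (hμ : ExpIntegrable μ fun _ => 1) (z : EuclideanSpace ℂ (Fin d))
    (P : MvPolynomial (Fin d) ℂ) :
    ‖expPoly hμ z P‖ = (eLpNorm (fun ξ => expFun z ξ * polyFun P ξ) 2 μ).toReal :=
  Lp.norm_toLp _ (hμ.memLp_expFun_mul_polyFun z P)

theorem inner_expPoly (hμ : ExpIntegrable μ fun _ => 1) (g : Lp ℂ 2 μ)
    (z : EuclideanSpace ℂ (Fin d)) (P : MvPolynomial (Fin d) ℂ) :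
    inner ℂ g (expPoly hμ z P) = expPairing μ (fun ξ => conj (g ξ)) z P := by
  rw [L2.inner_def, expPairing]
  refine integral_congr_ae ?_
  filter_upwards [coeFn_expPoly hμ z P] with ξ hξ
  rw [hξ, RCLike.inner_apply, mul_comm]

theorem linearCombination_expPoly (hμ : ExpIntegrable μ fun _ => 1) {ι : Type*}
    (x : ι → EuclideanSpace ℂ (Fin d)) (c : ι →₀ ℂ) :
    Finsupp.linearCombination ℂ (fun i => expPoly hμ (x i) 1) c =ᵐ[μ] expSum x c := by
  rw [Finsupp.linearCombination_apply, Finsupp.sum]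
  refine (Lp.coeFn_finsetSum _ _).trans ?_
  have h2 : ∀ᵐ ξ ∂μ, ∀ i ∈ c.support, (c i • expPoly hμ (x i) 1 :) ξ = c i * expFun (x i) ξ := by
    refine (Finset.eventually_all c.support).2 fun i _ => ?_
    filter_upwards [Lp.coeFn_smul (c i) (expPoly hμ (x i) 1), coeFn_expPoly hμ (x i) 1]
      with ξ h3 h4
    rw [h3, Pi.smul_apply, h4, smul_eq_mul]
    simp [polyFun]
  filter_upwards [h2] with ξ hξ
  rw [Finset.sum_apply, expSum]
  exact Finset.sum_congr rfl hξ

theorem norm_linearCombination_expPoly (hμ : ExpIntegrable μ fun _ => 1) {ι : Type*}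
    (x : ι → EuclideanSpace ℂ (Fin d)) (c : ι →₀ ℂ) :
    ‖Finsupp.linearCombination ℂ (fun i => expPoly hμ (x i) 1) c‖ =
      (eLpNorm (expSum x c) 2 μ).toReal := by
  rw [Lp.norm_def, eLpNorm_congr_ae (linearCombination_expPoly hμ x c)]

/-- The family of exponentials `x ∈ U` is sent to that of the exponentials `F x` by a bounded
operator. -/
def ExpBounded (hμ : ExpIntegrable μ fun _ => 1) (U : Set (EuclideanSpace ℝ (Fin d)))
    (F : EuclideanSpace ℂ (Fin d) → EuclideanSpace ℂ (Fin d)) : Prop :=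
  ∃ C : ℝ, ∀ c : U →₀ ℂ,
    ‖Finsupp.linearCombination ℂ (fun x : U => expPoly hμ (F (realToComplex x)) 1) c‖ ≤
      C * ‖Finsupp.linearCombination ℂ (fun x : U => expPoly hμ (realToComplex x) 1) c‖

/-- The exponentials from `U` are not assumed total here: extend to their closed span and precompose
with the orthogonal projection. -/
theorem exists_clm_of_linearCombination_bound {ι H H' : Type*}
    [NormedAddCommGroup H] [InnerProductSpace ℂ H] [CompleteSpace H]
    [NormedAddCommGroup H'] [InnerProductSpace ℂ H'] [CompleteSpace H']
    (x : ι → H) (y : ι → H') (C : ℝ)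
    (h : ∀ c : ι →₀ ℂ,
      ‖Finsupp.linearCombination ℂ y c‖ ≤ C * ‖Finsupp.linearCombination ℂ x c‖) :
    ∃ T : H →L[ℂ] H', ∀ i, T (x i) = y i := by
  let S := Submodule.span ℂ (Set.range x)
  have hxS : ∀ i, x i ∈ S.topologicalClosure := fun i =>
    S.le_topologicalClosure (Submodule.subset_span ⟨i, rfl⟩)
  let x' : ι → S.topologicalClosure := fun i => ⟨x i, hxS i⟩
  have : CompleteSpace S.topologicalClosure :=
    S.isClosed_topologicalClosure.completeSpace_coe
  have hnorm : ∀ c : ι →₀ ℂ, (Finsupp.linearCombination ℂ x' c : H) =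
      Finsupp.linearCombination ℂ x c := fun c => by
    simp [Finsupp.linearCombination_apply, Finsupp.sum, x']
  obtain ⟨T, hT⟩ := exists_clm_of_linearCombination_bound_of_dense x' y (by
    rw [Submodule.topologicalClosure_eq_top_iff, Submodule.eq_bot_iff]
    rintro ⟨g, hg⟩ hgo
    have h1 : g ∈ Sᗮ := by
      refine (Submodule.mem_orthogonal _ _).2 fun w hw => ?_
      induction hw using Submodule.span_induction with
      | mem w hw =>
        obtain ⟨i, rfl⟩ := hw
        exact (Submodule.mem_orthogonal _ _).1 hgo (x' i) (Submodule.subset_span ⟨i, rfl⟩)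
      | zero => simp
      | add a b _ _ ha hb => rw [inner_add_left, ha, hb, add_zero]
      | smul a b _ hb => rw [inner_smul_left, hb, mul_zero]
    rw [← Submodule.orthogonal_closure] at h1
    have h2 := (Submodule.mem_orthogonal _ _).1 h1 g hg
    exact Subtype.ext (inner_self_eq_zero.1 h2)) C (fun c => by
      have := h c
      rwa [← hnorm] at this)
  refine ⟨T.comp S.topologicalClosure.orthogonalProjectionOnto, fun i => ?_⟩
  rw [ContinuousLinearMap.comp_apply, ← hT i]
  congr 1
  exact Submodule.orthogonalProjectionOnto_mem_subspace_eq_self (x' i)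

/-- Pair with an arbitrary `b`. For `g₁ = conj (K* b)` and `g₂ = conj b`, the hypothesis inside
`Intertwines` says `⟨b, K e_x⟩ = ⟨b, e_{F x}⟩` on `U`, and its conclusion is the claim tested
against `b`. -/
theorem ExpBounded.exists_clm {hμ : ExpIntegrable μ fun _ => 1}
    {U : Set (EuclideanSpace ℝ (Fin d))}
    {F : EuclideanSpace ℂ (Fin d) → EuclideanSpace ℂ (Fin d)} (h : ExpBounded hμ U F) :
    ∃ K : Lp ℂ 2 μ →L[ℂ] Lp ℂ 2 μ, ∀ P R, Intertwines μ U F P R → ∀ z,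
      K (expPoly hμ z P) = expPoly hμ (F z) (R z) := by
  obtain ⟨C, hC⟩ := h
  obtain ⟨K, hK⟩ := exists_clm_of_linearCombination_bound _ _ C hC
  refine ⟨K, fun P R hPR z => ?_⟩
  have hexp : ∀ g : Lp ℂ 2 μ, ExpIntegrable μ fun ξ => conj (g ξ) := fun g =>
    hμ.of_memLp_two (Lp.memLp g).star
  refine ext_inner_left ℂ fun b => ?_
  rw [← ContinuousLinearMap.adjoint_inner_left, inner_expPoly, inner_expPoly]
  refine hPR _ _ (hexp _) (hexp _) (fun x hx => ?_) z
  rw [← inner_expPoly hμ, ← inner_expPoly hμ, ContinuousLinearMap.adjoint_inner_left]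
  rw [hK ⟨x, hx⟩]

/-- The complex conjugate of a vector in `ℂᵈ`. -/
noncomputable def conjVec (z : EuclideanSpace ℂ (Fin d)) : EuclideanSpace ℂ (Fin d) :=
  WithLp.toLp 2 fun i => conj (z i)

theorem conj_expFun_conjVec_mul (z : EuclideanSpace ℂ (Fin d)) (ξ : EuclideanSpace ℝ (Fin d)) :
    conj (expFun (conjVec z) ξ) * expFun z ξ = 1 := by
  rw [expFun, expFun, ← Complex.exp_conj, ← Complex.exp_add, ← Complex.exp_zero]
  congr 1
  have : conj (2 : ℂ) = 2 := map_ofNat _ 2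
  simp [conjVec, this]

/-- Since `conj(e_{z̄}) e_z = 1`, the left side is `⟨e_{z̄} P, e_z P⟩`, and Cauchy–Schwarz applies.
This turns the upper bounds of (B) into lower bounds. -/
theorem norm_sq_expPoly_zero_le (hμ : ExpIntegrable μ fun _ => 1) (z : EuclideanSpace ℂ (Fin d))
    (P : MvPolynomial (Fin d) ℂ) :
    ‖expPoly hμ 0 P‖ ^ 2 ≤ ‖expPoly hμ (conjVec z) P‖ * ‖expPoly hμ z P‖ := by
  have h1 : inner ℂ (expPoly hμ (conjVec z) P) (expPoly hμ z P) =
      inner ℂ (expPoly hμ 0 P) (expPoly hμ 0 P) := by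
    rw [L2.inner_def, L2.inner_def]
    refine integral_congr_ae ?_
    filter_upwards [coeFn_expPoly hμ z P, coeFn_expPoly hμ (conjVec z) P, coeFn_expPoly hμ 0 P]
      with ξ h1 h2 h3
    rw [h1, h2, h3, RCLike.inner_apply, RCLike.inner_apply, map_mul, map_mul, expFun_zero]
    have := conj_expFun_conjVec_mul z ξ
    simp only [map_one, one_mul]
    calc _ = (conj (expFun (conjVec z) ξ) * expFun z ξ) * (polyFun P ξ * conj (polyFun P ξ)) := by
          ring
      _ = _ := by rw [this, one_mul]
  have h2 := norm_inner_le_norm (𝕜 := ℂ) (expPoly hμ (conjVec z) P) (expPoly hμ z P)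
  rw [h1, inner_self_eq_norm_sq_to_K] at h2
  simpa using h2

/-- A polynomial with leading form a power of a nonzero linear form vanishes only on a null set. -/
theorem ae_polyFun_linPoly_pow_add_ne_zero {v : EuclideanSpace ℂ (Fin d)} (hv : v ≠ 0) {m : ℕ}
    {Q : MvPolynomial (Fin d) ℂ} (hQ : Q.totalDegree ≤ m) :
    ∀ᵐ ξ : EuclideanSpace ℝ (Fin d), polyFun (linPoly v ^ (m + 1) + Q) ξ ≠ 0 := by
  obtain ⟨i, hi⟩ : ∃ i, v i ≠ 0 := by
    by_contra! hcon
    exact hv (by ext i; simpa using hcon i)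
  set P := linPoly v ^ (m + 1) + Q with hP
  have hmeas : MeasurableSet {ξ : EuclideanSpace ℝ (Fin d) | polyFun P ξ ≠ 0} :=
    (continuous_polyFun P).measurable (measurableSet_singleton 0).compl
  -- Fubini along lines parallel to `e_i`: as `v i ≠ 0`, the restriction to each line has degree
  -- exactly `m + 1` and so finitely many zeros.
  refine ae_mem_of_ae_add_linearMap_mem
    (LinearMap.toSpanSingleton ℝ (EuclideanSpace ℝ (Fin d)) (EuclideanSpace.single i 1))
    volume volume hmeas fun y => ?_
  let φ : Fin d → Polynomial ℂ := fun j =>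
    Polynomial.C ((EuclideanSpace.single i (1 : ℂ) : EuclideanSpace ℂ (Fin d)) j) * Polynomial.X +
      Polynomial.C (y j : ℂ)
  have hφ : ∀ j, (φ j).natDegree ≤ 1 := fun j => Polynomial.natDegree_linear_le
  have heval : ∀ (t : ℝ) (S : MvPolynomial (Fin d) ℂ),
      polyFun S (y + t • EuclideanSpace.single i (1 : ℝ)) =
        (MvPolynomial.aeval φ S).eval (t : ℂ) := fun t S => by
    induction S using MvPolynomial.induction_on with
    | C a => simp [polyFun]
    | add S T hS hT => rw [polyFun_add, hS, hT, map_add, Polynomial.eval_add]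
    | mul_X S j hS =>
      rw [polyFun_mul, hS, map_mul, Polynomial.eval_mul]
      congr 1
      simp [polyFun, φ]
      split_ifs <;> simp [add_comm]
  have hlin : MvPolynomial.aeval φ (linPoly v) =
      Polynomial.C (v i) * Polynomial.X + Polynomial.C (∑ j, v j * y j) := by
    simp only [linPoly, LinearMap.coe_mk, AddHom.coe_mk, map_sum, map_smul, MvPolynomial.aeval_X, φ,
      smul_add, Finset.sum_add_distrib, Polynomial.smul_eq_C_mul, map_mul]
    congr 1
    rw [Finset.sum_eq_single i]
    · simp
    · intro j _ hj
      simp [hj]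
    · simp
  have hne : MvPolynomial.aeval φ P ≠ 0 := by
    intro h0
    rw [hP, map_add, map_pow, hlin] at h0
    have h1 := MvPolynomial.aeval_natDegree_le Q hQ φ hφ
    have h2 := congrArg Polynomial.natDegree (eq_neg_of_add_eq_zero_left h0)
    rw [Polynomial.natDegree_neg, Polynomial.natDegree_pow, Polynomial.natDegree_linear hi] at h2
    omega
  have hfin : {t : ℝ | (MvPolynomial.aeval φ P).eval (t : ℂ) = 0}.Finite :=
    Set.Finite.preimage Complex.ofReal_injective.injOn (Polynomial.finite_setOfPred_isRoot hne)
  filter_upwards [compl_mem_ae_iff.2 (hfin.measure_zero volume)] with t ht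
  show polyFun P (y + t • EuclideanSpace.single i (1 : ℝ)) ≠ 0
  rw [heval]
  exact ht

theorem expPoly_linPoly_pow_add_ne_zero (hμ : ExpIntegrable μ fun _ => 1) (hac : μ ≪ volume)
    (hμ0 : μ ≠ 0) {v : EuclideanSpace ℂ (Fin d)} (hv : v ≠ 0) {m : ℕ}
    {Q : MvPolynomial (Fin d) ℂ} (hQ : Q.totalDegree ≤ m) :
    expPoly hμ 0 (linPoly v ^ (m + 1) + Q) ≠ 0 := by
  intro h0
  rw [Lp.eq_zero_iff_ae_eq_zero] at h0
  have : ∀ᵐ ξ ∂μ, False := by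
    filter_upwards [h0, coeFn_expPoly hμ 0 (linPoly v ^ (m + 1) + Q),
      hac.ae_le (ae_polyFun_linPoly_pow_add_ne_zero hv hQ)] with ξ h1 h2 h3
    rw [h1, expFun_zero, one_mul] at h2
    exact h3 h2.symm
  rw [eventually_false_iff_eq_bot, ae_eq_bot] at this
  exact hμ0 this

/-- The power of a linear form has a closest polynomial of lower degree. -/
theorem exists_norm_expPoly_linPoly_pow_le (hμ : ExpIntegrable μ fun _ => 1) (hac : μ ≪ volume)
    (hμ0 : μ ≠ 0) {v : EuclideanSpace ℂ (Fin d)} (hv : v ≠ 0) (m : ℕ) :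
    ∃ Q : MvPolynomial (Fin d) ℂ, Q.totalDegree ≤ m ∧
      0 < ‖expPoly hμ 0 (linPoly v ^ (m + 1) + Q)‖ ∧
      ∀ a : ℂ, a ≠ 0 → ∀ T : MvPolynomial (Fin d) ℂ, T.totalDegree ≤ m →
        ‖a‖ * ‖expPoly hμ 0 (linPoly v ^ (m + 1) + Q)‖ ≤
          ‖expPoly hμ 0 (a • linPoly v ^ (m + 1) + T)‖ := by
  generalize hp : linPoly v ^ (m + 1) = p
  let W : Submodule ℂ (Lp ℂ 2 μ) :=
    (MvPolynomial.restrictTotalDegree (Fin d) ℂ m).map (expPoly hμ 0)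
  -- Project `p` onto the finite-dimensional space of polynomials of degree at most `m`; the
  -- minimiser is `p - Q`.
  obtain ⟨Q, hQ, hQW⟩ := (Submodule.mem_map).1 (W.starProjection_apply_mem (expPoly hμ 0 p))
  have hQdeg : (-Q).totalDegree ≤ m := by
    rw [MvPolynomial.totalDegree_neg]
    exact (MvPolynomial.mem_restrictTotalDegree _ _ _).1 hQ
  have hmin : ∀ S : MvPolynomial (Fin d) ℂ, S.totalDegree ≤ m →
      ‖expPoly hμ 0 (p + -Q)‖ ≤ ‖expPoly hμ 0 (p - S)‖ := fun S hS => by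
    rw [← sub_eq_add_neg, map_sub, map_sub, hQW, Submodule.starProjection_minimal]
    exact ciInf_le ⟨0, by rintro _ ⟨w, rfl⟩; exact norm_nonneg _⟩
      (⟨expPoly hμ 0 S, Submodule.mem_map_of_mem
        ((MvPolynomial.mem_restrictTotalDegree _ _ _).2 hS)⟩ : W)
  refine ⟨-Q, hQdeg, ?_, fun a ha T hT => ?_⟩
  · rw [norm_pos_iff, ← hp]
    exact expPoly_linPoly_pow_add_ne_zero hμ hac hμ0 hv hQdeg
  · have e : a • p + T = a • (p - (-a⁻¹) • T) := by
      rw [smul_sub, smul_smul, mul_neg, mul_inv_cancel₀ ha, neg_one_smul, sub_neg_eq_add]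
    rw [e, map_smul, norm_smul]
    exact mul_le_mul_of_nonneg_left
      (hmin _ ((MvPolynomial.totalDegree_smul_le _ _).trans hT)) (norm_nonneg a)

theorem norm_expPoly_zero_le_of_conjVec (hμ : ExpIntegrable μ fun _ => 1)
    (z : EuclideanSpace ℂ (Fin d)) (P : MvPolynomial (Fin d) ℂ) {K : ℝ} (hK : 0 ≤ K)
    (h : ‖expPoly hμ (conjVec z) P‖ ≤ K * ‖expPoly hμ 0 P‖) :
    ‖expPoly hμ 0 P‖ ≤ K * ‖expPoly hμ z P‖ := by
  have h3 := norm_sq_expPoly_zero_le hμ z P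
  have ha := norm_nonneg (expPoly hμ 0 P)
  have hb := norm_nonneg (expPoly hμ z P)
  generalize ‖expPoly hμ 0 P‖ = a, ‖expPoly hμ z P‖ = b, ‖expPoly hμ (conjVec z) P‖ = c at *
  rcases ha.eq_or_lt with h5 | h5
  · rw [← h5]; positivity
  · refine le_of_mul_le_mul_left ?_ h5
    calc a * a = a ^ 2 := by ring
      _ ≤ c * b := h3
      _ ≤ (K * a) * b := by gcongr
      _ = _ := by ring

/-- Eigenvalues of the derivative of a symbol are bounded by the growth rate. -/
theorem ExpBounded.norm_eigenvalue_le {hμ : ExpIntegrable μ fun _ => 1} (hac : μ ≪ volume)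
    (hμ0 : μ ≠ 0) {M : ℝ} (hM : 0 < M)
    (hgrow : ∀ z, ∀ᶠ m : ℕ in atTop, ∀ P : MvPolynomial (Fin d) ℂ, P.totalDegree ≤ m →
      ‖expPoly hμ z P‖ ≤ M ^ m * ‖expPoly hμ 0 P‖)
    {U : Set (EuclideanSpace ℝ (Fin d))} (hU : IsOpen U) (hne : U.Nonempty)
    {F : EuclideanSpace ℂ (Fin d) → EuclideanSpace ℂ (Fin d)} (hF : Differentiable ℂ F)
    (h : ExpBounded hμ U F) {z v : EuclideanSpace ℂ (Fin d)} {lam : ℂ} (hv : v ≠ 0)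
    (hlam : fderiv ℂ F z v = lam • v) : ‖lam‖ ≤ M ^ 2 := by
  obtain ⟨K, hK⟩ := h.exists_clm
  obtain ⟨C, hC0, hC⟩ : ∃ C : ℝ, 0 ≤ C ∧ ∀ P R, Intertwines μ U F P R → ∀ z,
      ‖expPoly hμ (F z) (R z)‖ ≤ C * ‖expPoly hμ z P‖ :=
    ⟨‖K‖, norm_nonneg _, fun P R hPR z => by rw [← hK P R hPR z]; exact K.le_opNorm _⟩
  -- Minimality compares only polynomials with nonzero leading coefficient `lam ^ (m + 1)`.
  rcases eq_or_ne lam 0 with rfl | hlam0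
  · rw [norm_zero]; positivity
  have key : ∀ᶠ m : ℕ in atTop, ‖lam‖ ^ m ≤ C * (M ^ 2) ^ m := by
    rw [← map_add_atTop_eq_nat 1, eventually_map]
    have hg1 := (tendsto_add_atTop_nat 1).eventually (hgrow z)
    -- Growth at the conjugate frequency is what bounds `‖q‖` by `‖e_{F(z)} q‖`.
    have hg2 := (tendsto_add_atTop_nat 1).eventually (hgrow (conjVec (F z)))
    filter_upwards [hg1, hg2] with m h1 h2
    have hpdeg : (linPoly v ^ (m + 1)).totalDegree ≤ m + 1 := by
      refine (MvPolynomial.totalDegree_pow _ _).trans ?_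
      exact (Nat.mul_le_mul_left _ (totalDegree_linPoly_le v)).trans (by simp)
    obtain ⟨Q, hQdeg, hpos, hmin⟩ := exists_norm_expPoly_linPoly_pow_le hμ hac hμ0 hv m
    obtain ⟨R, hR, hI⟩ := exists_intertwines_linPoly_pow (μ := μ) hF hU hne v m
    obtain ⟨S, hS, hJ⟩ := exists_intertwines (μ := μ) hF hU hne m Q hQdeg
    have hbd := hC _ _ (hI.add hJ) z
    have hTdeg : (R z + S z).totalDegree ≤ m :=
      totalDegree_le_of_mem_holPoly (Submodule.add_mem _ hR hS) z
    rw [hlam, map_smul, smul_pow, add_assoc] at hbd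
    have hlow := hmin _ (pow_ne_zero (m + 1) hlam0) _ hTdeg
    rw [norm_pow] at hlow
    have hBdeg : (lam ^ (m + 1) • linPoly v ^ (m + 1) + (R z + S z)).totalDegree ≤ m + 1 :=
      (MvPolynomial.totalDegree_add _ _).trans (max_le
        ((MvPolynomial.totalDegree_smul_le _ _).trans hpdeg) (hTdeg.trans (Nat.le_succ m)))
    have hup := norm_expPoly_zero_le_of_conjVec hμ (F z) _ (pow_nonneg hM.le (m + 1))
      (h2 _ hBdeg)
    have hlast := h1 (linPoly v ^ (m + 1) + Q) ((MvPolynomial.totalDegree_add _ _).trans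
      (max_le hpdeg (hQdeg.trans (Nat.le_succ m))))
    refine le_of_mul_le_mul_right ?_ hpos
    generalize ‖expPoly hμ 0 (linPoly v ^ (m + 1) + Q)‖ = a,
      ‖expPoly hμ z (linPoly v ^ (m + 1) + Q)‖ = b,
      ‖expPoly hμ 0 (lam ^ (m + 1) • linPoly v ^ (m + 1) + (R z + S z))‖ = e,
      ‖expPoly hμ (F z) (lam ^ (m + 1) • linPoly v ^ (m + 1) + (R z + S z))‖ = e' at *
    calc _ ≤ e := hlow
      _ ≤ M ^ (m + 1) * e' := hup
      _ ≤ M ^ (m + 1) * (C * b) := by gcongr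
      _ ≤ M ^ (m + 1) * (C * (M ^ (m + 1) * a)) := by gcongr
      _ = _ := by rw [← pow_mul, mul_comm 2, pow_mul]; ring
  by_contra! hlt
  have hM2 : 0 < M ^ 2 := by positivity
  -- If `‖lam‖ > M ^ 2`, geometric growth overtakes the constant `C`.
  have h1 : Tendsto (fun m : ℕ => (‖lam‖ / M ^ 2) ^ m) atTop atTop :=
    tendsto_pow_atTop_atTop_of_one_lt ((one_lt_div hM2).2 hlt)
  obtain ⟨m, h2, h3⟩ := (key.and (h1.eventually_gt_atTop C)).exists
  rw [div_pow, lt_div_iff₀ (by positivity)] at h3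
  linarith

end ExpPoly

/-! ### Dilations of a weight -/

section Dilation
variable {d : ℕ}

/-- The measure `w dξ` of a nonnegative weight `w`. -/
noncomputable def weightMeasure (w : EuclideanSpace ℝ (Fin d) → ℂ) :
    Measure (EuclideanSpace ℝ (Fin d)) :=
  volume.withDensity fun ξ => ENNReal.ofReal (w ξ).re

theorem det_toEuclideanLin (A : Matrix (Fin d) (Fin d) ℝ) :
    LinearMap.det (Matrix.toEuclideanLin A) = A.det := by
  rw [Matrix.toEuclideanLin_eq_toLin_orthonormal, LinearMap.det_toLin]

theorem continuous_toEuclideanLin (A : Matrix (Fin d) (Fin d) ℝ) :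
    Continuous (Matrix.toEuclideanLin A) :=
  LinearMap.continuous_of_finiteDimensional _

theorem measurable_ofReal_re {w : EuclideanSpace ℝ (Fin d) → ℂ} (hw : Measurable w) :
    Measurable fun ξ => ENNReal.ofReal (w ξ).re :=
  (Complex.measurable_re.comp hw).ennreal_ofReal

theorem setLIntegral_comp_toEuclideanLin {A : Matrix (Fin d) (Fin d) ℝ} (hA : IsUnit A)
    {g : EuclideanSpace ℝ (Fin d) → ℝ≥0∞} (hg : Measurable g)
    {S : Set (EuclideanSpace ℝ (Fin d))} (hS : MeasurableSet S) :
    ∫⁻ ξ in Matrix.toEuclideanLin A ⁻¹' S, g (Matrix.toEuclideanLin A ξ) =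
      ENNReal.ofReal |A.det⁻¹| * ∫⁻ ξ in S, g ξ := by
  have hdet : LinearMap.det (Matrix.toEuclideanLin A) ≠ 0 := by
    rw [det_toEuclideanLin]
    exact ((Matrix.isUnit_iff_isUnit_det A).1 hA).ne_zero
  have hm := (continuous_toEuclideanLin A).measurable
  rw [← setLIntegral_map hS hg hm, Measure.map_linearMap_addHaar_eq_smul_addHaar volume hdet,
    det_toEuclideanLin, Measure.restrict_smul, lintegral_smul_measure, smul_eq_mul]

theorem map_weightMeasure_le_of_mem_dilationSet {w : EuclideanSpace ℝ (Fin d) → ℂ}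
    (hw : Measurable w) {A : Matrix (Fin d) (Fin d) ℝ} (hA : A ∈ dilationSet w) :
    ∃ C : ℝ≥0∞, C ≠ ⊤ ∧
      (weightMeasure w).map (Matrix.toEuclideanLin A.transpose) ≤ C • weightMeasure w := by
  obtain ⟨hu, lam, hlam, hle⟩ := hA
  have hut : IsUnit A.transpose := (Matrix.isUnit_transpose A).2 hu
  have hm := (continuous_toEuclideanLin A.transpose).measurable
  have hWm := measurable_ofReal_re hw
  have hWm' : Measurable fun ξ =>
      ENNReal.ofReal (w (Matrix.toEuclideanLin A.transpose ξ)).re := hWm.comp hm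
  -- One factor comes from the inequality for `w`, the other from the Jacobian.
  refine ⟨ENNReal.ofReal lam⁻¹ * ENNReal.ofReal |A.transpose.det⁻¹|,
    ENNReal.mul_ne_top ENNReal.ofReal_ne_top ENNReal.ofReal_ne_top,
    Measure.le_iff.2 fun S hS => ?_⟩
  rw [Measure.map_apply hm hS, Measure.smul_apply, smul_eq_mul, mul_assoc, weightMeasure,
    withDensity_apply _ hS, withDensity_apply _ (hm hS),
    ← setLIntegral_comp_toEuclideanLin hut hWm hS,
    ← lintegral_const_mul _ hWm']
  refine lintegral_mono_ae (ae_restrict_of_ae ?_)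
  filter_upwards [hle] with ξ hξ
  have h1 := (Complex.le_def.1 hξ).1
  rw [Complex.re_ofReal_mul] at h1
  rw [← ENNReal.ofReal_mul (by positivity)]
  refine ENNReal.ofReal_le_ofReal ?_
  rw [inv_mul_eq_div, le_div_iff₀ hlam, mul_comm]
  exact h1

/-- If `A` were singular, the image measure would live on a proper subspace, which is null for `w
dξ`, and so would be zero. For invertible `A`, testing the domination on the sets `Aᵀ T` compares
the densities. -/
theorem mem_dilationSet_of_map_weightMeasure_le {w : EuclideanSpace ℝ (Fin d) → ℂ}
    (hw : Measurable w) (hpos : ∀ᵐ ξ, 0 ≤ w ξ) (h0 : weightMeasure w ≠ 0)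
    {A : Matrix (Fin d) (Fin d) ℝ} {C : ℝ≥0∞} (hC : C ≠ ⊤)
    (h : (weightMeasure w).map (Matrix.toEuclideanLin A.transpose) ≤ C • weightMeasure w) :
    A ∈ dilationSet w := by
  have hm := (continuous_toEuclideanLin A.transpose).measurable
  have hWm := measurable_ofReal_re hw
  have hWm' : Measurable fun ξ =>
      ENNReal.ofReal (w (Matrix.toEuclideanLin A.transpose ξ)).re := hWm.comp hm
  have hu : IsUnit A := by
    by_contra hcon
    have hr : LinearMap.range (Matrix.toEuclideanLin A.transpose) ≠ ⊤ := by
      intro hr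
      rw [← LinearMap.isUnit_iff_range_eq_top, LinearMap.isUnit_iff_isUnit_det,
        det_toEuclideanLin, Matrix.det_transpose, ← Matrix.isUnit_iff_isUnit_det] at hr
      exact hcon hr
    have hvol := Measure.addHaar_submodule (volume : Measure (EuclideanSpace ℝ (Fin d))) _ hr
    have hμ0 : weightMeasure w (LinearMap.range (Matrix.toEuclideanLin A.transpose)) = 0 :=
      withDensity_absolutelyContinuous _ _ hvol
    have h1 := Measure.le_iff'.1 h (LinearMap.range (Matrix.toEuclideanLin A.transpose))
    rw [Measure.smul_apply, hμ0, smul_zero, Measure.map_apply hm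
      (Submodule.closed_of_finiteDimensional _).measurableSet] at h1
    refine h0 (Measure.measure_univ_eq_zero.1 (le_antisymm (le_trans (le_of_eq ?_) h1) zero_le))
    congr 1
    ext ξ
    simp
  have hut : IsUnit A.transpose := (Matrix.isUnit_transpose A).2 hu
  have hdet := (Matrix.isUnit_iff_isUnit_det _).1 hut
  have hdet0 : A.transpose.det ≠ 0 := hdet.ne_zero
  let K : ℝ≥0∞ := C * ENNReal.ofReal |A.transpose.det|
  have hK : K ≠ ⊤ := ENNReal.mul_ne_top hC ENNReal.ofReal_ne_top
  have hle : (fun ξ => ENNReal.ofReal (w ξ).re) ≤ᵐ[volume]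
      fun ξ => K * ENNReal.ofReal (w (Matrix.toEuclideanLin A.transpose ξ)).re := by
    refine ae_le_of_forall_setLIntegral_le_of_sigmaFinite hWm fun T hT _ => ?_
    have hinv : ∀ ξ, Matrix.toEuclideanLin A.transpose⁻¹ (Matrix.toEuclideanLin A.transpose ξ) = ξ := by
      intro ξ
      rw [Matrix.toLpLin_apply, Matrix.toLpLin_apply]
      simp [Matrix.mulVec_mulVec, Matrix.nonsing_inv_mul _ hdet]
    let S := Matrix.toEuclideanLin A.transpose⁻¹ ⁻¹' T
    have hS : MeasurableSet S := (continuous_toEuclideanLin _).measurable hT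
    have hTS : Matrix.toEuclideanLin A.transpose ⁻¹' S = T := by
      ext ξ
      simp only [S, Set.mem_preimage, hinv]
    have h1 := Measure.le_iff'.1 h S
    rw [Measure.map_apply hm hS, hTS, Measure.smul_apply, weightMeasure, withDensity_apply _ hS,
      withDensity_apply _ hT, smul_eq_mul] at h1
    have h2 := setLIntegral_comp_toEuclideanLin hut hWm hS
    rw [hTS] at h2
    refine h1.trans (le_of_eq ?_)
    rw [lintegral_const_mul _ hWm', h2]
    simp only [K]
    rw [mul_assoc, ← mul_assoc (ENNReal.ofReal _), ← ENNReal.ofReal_mul (abs_nonneg _), ← abs_mul,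
      mul_inv_cancel₀ hdet0]
    simp
  have hqmp := Measure.LinearMap.quasiMeasurePreserving volume (Matrix.toEuclideanLin A.transpose) (by
    rwa [det_toEuclideanLin])
  -- Adding 1 keeps the constant positive without proving `K ≠ 0`.
  refine ⟨hu, (K.toReal + 1)⁻¹, by positivity, ?_⟩
  filter_upwards [hle, hpos, hqmp.ae hpos] with ξ h1 h2 h3
  obtain ⟨h2r, h2i⟩ := Complex.nonneg_iff.1 h2
  obtain ⟨h3r, h3i⟩ := Complex.nonneg_iff.1 h3
  refine Complex.le_def.2 ⟨?_, ?_⟩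
  · rw [Complex.re_ofReal_mul, inv_mul_le_iff₀ (by positivity)]
    have h4 := ENNReal.toReal_mono (ENNReal.mul_ne_top hK ENNReal.ofReal_ne_top) h1
    rw [ENNReal.toReal_mul, ENNReal.toReal_ofReal h2r, ENNReal.toReal_ofReal h3r] at h4
    linarith
  · rw [Complex.im_ofReal_mul, ← h2i, ← h3i, mul_zero]

/-- The complex-affine extension of `x ↦ A x + b`. -/
noncomputable def affineExt (A : Matrix (Fin d) (Fin d) ℝ) (b : EuclideanSpace ℝ (Fin d))
    (z : EuclideanSpace ℂ (Fin d)) : EuclideanSpace ℂ (Fin d) :=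
  Matrix.toEuclideanCLM (𝕜 := ℂ) (A.map (fun r => (r : ℂ))) z + realToComplex b

theorem affineExt_realToComplex (A : Matrix (Fin d) (Fin d) ℝ) (b x : EuclideanSpace ℝ (Fin d)) :
    affineExt A b (realToComplex x) = realToComplex (Matrix.toEuclideanLin A x + b) := by
  ext i
  simp [affineExt, realToComplex, Matrix.toLpLin_apply, Matrix.mulVec, dotProduct]

theorem expFun_toEuclideanLin (A : Matrix (Fin d) (Fin d) ℝ) (x ξ : EuclideanSpace ℝ (Fin d)) :
    expFun (realToComplex (Matrix.toEuclideanLin A x)) ξ =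
      expFun (realToComplex x) (Matrix.toEuclideanLin A.transpose ξ) := by
  rw [expFun, expFun]
  congr 2
  simp only [realToComplex, Matrix.toLpLin_apply, Matrix.mulVec, dotProduct,
    Matrix.transpose_apply]
  push_cast
  simp_rw [Finset.sum_mul, Finset.mul_sum]
  rw [Finset.sum_comm]
  refine Finset.sum_congr rfl fun i _ => Finset.sum_congr rfl fun j _ => by ring

/-- The translation contributes the unimodular factor `e_b`, and `(A x)ᵀξ = xᵀ(Aᵀξ)`. -/
theorem norm_expSum_affine {ι : Type*} (A : Matrix (Fin d) (Fin d) ℝ)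
    (b : EuclideanSpace ℝ (Fin d)) (x : ι → EuclideanSpace ℝ (Fin d)) (c : ι →₀ ℂ)
    (ξ : EuclideanSpace ℝ (Fin d)) :
    ‖expSum (fun i => realToComplex (Matrix.toEuclideanLin A (x i) + b)) c ξ‖ =
      ‖expSum (fun i => realToComplex (x i)) c (Matrix.toEuclideanLin A.transpose ξ)‖ := by
  have hadd : ∀ y, realToComplex (y + b) = realToComplex y + realToComplex b := fun y => by
    ext i; simp [realToComplex]
  have : expSum (fun i => realToComplex (Matrix.toEuclideanLin A (x i) + b)) c ξ =
      expSum (fun i => realToComplex (x i)) c (Matrix.toEuclideanLin A.transpose ξ) *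
        expFun (realToComplex b) ξ := by
    rw [expSum, expSum, Finset.sum_mul]
    refine Finset.sum_congr rfl fun i _ => ?_
    rw [hadd, expFun_add, expFun_toEuclideanLin, mul_assoc]
  rw [this, norm_mul, norm_expFun_realToComplex, mul_one]

theorem eLpNorm_expSum_affine (μ : Measure (EuclideanSpace ℝ (Fin d))) {ι : Type*}
    (A : Matrix (Fin d) (Fin d) ℝ)
    (b : EuclideanSpace ℝ (Fin d)) (x : ι → EuclideanSpace ℝ (Fin d)) (c : ι →₀ ℂ) :
    eLpNorm (expSum (fun i => realToComplex (Matrix.toEuclideanLin A (x i) + b)) c) 2 μ =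
      eLpNorm (expSum (fun i => realToComplex (x i)) c) 2
        (μ.map (Matrix.toEuclideanLin A.transpose)) := by
  rw [eLpNorm_map_measure (continuous_expSum _ c).aestronglyMeasurable
    (continuous_toEuclideanLin A.transpose).measurable.aemeasurable]
  exact eLpNorm_congr_norm_ae (Eventually.of_forall fun ξ => norm_expSum_affine A b x c ξ)

theorem exists_eLpNorm_expSum_affine_le {w : EuclideanSpace ℝ (Fin d) → ℂ} (hw : Measurable w)
    {A : Matrix (Fin d) (Fin d) ℝ} (hA : A ∈ dilationSet w) :
    ∃ C : ℝ≥0∞, C ≠ ⊤ ∧ ∀ (ι : Type) (b : EuclideanSpace ℝ (Fin d))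
      (x : ι → EuclideanSpace ℝ (Fin d)) (c : ι →₀ ℂ),
      eLpNorm (expSum (fun i => realToComplex (Matrix.toEuclideanLin A (x i) + b)) c) 2
        (weightMeasure w) ≤
      C * eLpNorm (expSum (fun i => realToComplex (x i)) c) 2 (weightMeasure w) := by
  obtain ⟨C, hC, hle⟩ := map_weightMeasure_le_of_mem_dilationSet hw hA
  refine ⟨C ^ (1 / (2 : ℝ≥0∞)).toReal, ENNReal.rpow_ne_top_of_nonneg (by positivity) hC, fun ι b x c => ?_⟩
  rw [eLpNorm_expSum_affine, ← smul_eq_mul, ← eLpNorm_smul_measure_of_ne_top (by simp)]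
  exact eLpNorm_mono_measure _ hle

end Dilation

/-! ### Symbols of bounded operators are affine -/

section Affine
variable {d : ℕ}

/-- The trace is the sum of the `d` eigenvalues, counted with multiplicity. -/
theorem norm_trace_le_of_eigenvalue_le (T : Module.End ℂ (EuclideanSpace ℂ (Fin d))) (K : ℝ)
    (h : ∀ (lam : ℂ) (v : EuclideanSpace ℂ (Fin d)), v ≠ 0 → T v = lam • v → ‖lam‖ ≤ K) :
    ‖LinearMap.trace ℂ _ T‖ ≤ d * K := by
  rw [Module.End.trace_eq_sum_roots_charpoly_of_splits (IsAlgClosed.splits _)]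
  refine (norm_multiset_sum_le _).trans ?_
  refine (Multiset.sum_le_card_nsmul _ K fun x hx => ?_).trans ?_
  · obtain ⟨lam, hlam, rfl⟩ := Multiset.mem_map.1 hx
    have h1 := (Module.End.hasEigenvalue_iff_isRoot_charpoly T lam).2
      (Polynomial.isRoot_of_mem_roots hlam)
    obtain ⟨v, hv⟩ := h1.exists_hasEigenvector
    exact h lam v hv.2 hv.apply_eq_smul
  · rw [Multiset.card_map, Polynomial.splits_iff_card_roots.1 (IsAlgClosed.splits _),
      LinearMap.charpoly_natDegree]
    simp

theorem trace_eq_sum_apply_single (T : Module.End ℂ (EuclideanSpace ℂ (Fin d))) :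
    LinearMap.trace ℂ _ T = ∑ i, T (EuclideanSpace.single i 1) i := by
  rw [LinearMap.trace_eq_matrix_trace ℂ (EuclideanSpace.basisFun (Fin d) ℂ).toBasis]
  simp [Matrix.trace, LinearMap.toMatrix_apply]

theorem ExpBounded.exists_eq_affine {w : EuclideanSpace ℝ (Fin d) → ℂ} (hw : Measurable w)
    (hμ : ExpIntegrable (weightMeasure w) fun _ => 1) (hμ0 : weightMeasure w ≠ 0)
    {M : ℝ} (hM : 0 < M)
    (hgrow : ∀ z, ∀ᶠ m : ℕ in atTop, ∀ P : MvPolynomial (Fin d) ℂ, P.totalDegree ≤ m →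
      ‖expPoly hμ z P‖ ≤ M ^ m * ‖expPoly hμ 0 P‖)
    (hspan : Submodule.span ℝ (dilationSet w) = ⊤)
    {U : Set (EuclideanSpace ℝ (Fin d))} (hU : IsOpen U) (hne : U.Nonempty)
    {f : U → EuclideanSpace ℝ (Fin d)}
    {F : EuclideanSpace ℂ (Fin d) → EuclideanSpace ℂ (Fin d)} (hF : Differentiable ℂ F)
    (hFf : ∀ x : U, F (realToComplex x) = realToComplex (f x)) (h : ExpBounded hμ U F) :
    ∃ (A : Matrix (Fin d) (Fin d) ℝ) (b : EuclideanSpace ℝ (Fin d)),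
      ∀ x : U, f x = Matrix.toEuclideanLin A (x : EuclideanSpace ℝ (Fin d)) + b := by
  have hac : weightMeasure w ≪ volume := withDensity_absolutelyContinuous _ _
  have hfin : IsFiniteMeasure (weightMeasure w) := by
    have := hμ.integrable
    rw [integrable_const_iff] at this
    exact this.resolve_left one_ne_zero
  -- Composing with `A` changes the operator norm but not `M`, so the eigenvalue bound for `A ∘ F`
  -- is still `M ^ 2`.
  have hbdd : ∀ A ∈ dilationSet w, ExpBounded hμ U fun z => affineExt A 0 (F z) := by
    intro A hA
    obtain ⟨C, hC⟩ := h
    obtain ⟨C', hC', hA'⟩ := exists_eLpNorm_expSum_affine_le hw hA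
    refine ⟨C'.toReal * C, fun c => ?_⟩
    refine le_trans ?_ ((mul_le_mul_of_nonneg_left (hC c) ENNReal.toReal_nonneg).trans_eq
      (mul_assoc _ _ _).symm)
    rw [norm_linearCombination_expPoly, norm_linearCombination_expPoly, ← ENNReal.toReal_mul]
    simp only [hFf, affineExt_realToComplex]
    exact ENNReal.toReal_mono (ENNReal.mul_ne_top hC' (memLp_expSum _ _ c).2.ne)
      (hA' U 0 f c)
  let D : EuclideanSpace ℂ (Fin d) → Fin d → Fin d → ℂ := fun z j i =>
    fderiv ℂ F z (EuclideanSpace.single i 1) j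
  have hD : ∀ i j, Differentiable ℂ fun z => D z j i := fun i j =>
    differentiable_euclidean.1 (hF.differentiable_fderiv_apply_euclidean _) j
  -- The real matrices `A` for which `tr(A DF_z)` does not depend on `z`.
  let S : Submodule ℝ (Matrix (Fin d) (Fin d) ℝ) :=
    { carrier := {A | ∀ z, ∑ i, ∑ j, (A i j : ℂ) * D z j i = ∑ i, ∑ j, (A i j : ℂ) * D 0 j i}
      zero_mem' := fun z => by simp
      add_mem' := fun {A B} hA hB z => by
        simp only [Matrix.add_apply, Complex.ofReal_add, add_mul, Finset.sum_add_distrib]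
        rw [hA z, hB z]
      smul_mem' := fun r A hA z => by
        simp only [Matrix.smul_apply, smul_eq_mul, Complex.ofReal_mul, mul_assoc,
          ← Finset.mul_sum]
        rw [hA z] }
  have hdS : dilationSet w ⊆ S := by
    intro A hA z
    refine Differentiable.apply_eq_apply_of_bounded
      (f := fun z => ∑ i, ∑ j, (A i j : ℂ) * D z j i) ?_ ?_ z 0
    · exact Differentiable.fun_sum fun i _ => Differentiable.fun_sum fun j _ =>
        (hD i j).const_mul _
    · rw [isBounded_iff_forall_norm_le]
      refine ⟨d * M ^ 2, ?_⟩
      rintro _ ⟨z, rfl⟩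
      have hd : Differentiable ℂ fun z => affineExt A 0 (F z) :=
        ((ContinuousLinearMap.differentiable _).comp hF).add_const _
      have hfd : fderiv ℂ (fun z => affineExt A 0 (F z)) z =
          (Matrix.toEuclideanCLM (𝕜 := ℂ) (A.map (fun r => (r : ℂ)))).comp (fderiv ℂ F z) :=
        (((ContinuousLinearMap.hasFDerivAt _).comp z (hF z).hasFDerivAt).add_const _).fderiv
      have htr := norm_trace_le_of_eigenvalue_le
        (fderiv ℂ (fun z => affineExt A 0 (F z)) z : Module.End ℂ (EuclideanSpace ℂ (Fin d)))
        (M ^ 2) fun lam v hv hlam =>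
          (hbdd A hA).norm_eigenvalue_le hac hμ0 hM hgrow hU hne hd hv hlam
      rw [trace_eq_sum_apply_single, hfd] at htr
      refine le_trans (le_of_eq ?_) htr
      congr 1
  have hST : S = ⊤ := by
    rw [eq_top_iff, ← hspan]
    exact Submodule.span_le.2 hdS
  have hDconst : ∀ z i j, D z j i = D 0 j i := fun z i j => by
    -- For an elementary matrix the trace is a single entry of the Jacobian.
    have h1 : Matrix.single i j (1 : ℝ) ∈ S := by rw [hST]; trivial
    have h2 : ∀ z, ∑ i', ∑ j', ((Matrix.single i j (1 : ℝ) i' j' : ℝ) : ℂ) * D z j' i' = D z j i := by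
      intro z
      rw [Finset.sum_eq_single i, Finset.sum_eq_single j]
      · simp
      · intro j' _ hj'
        simp [hj'.symm]
      · simp
      · intro i' _ hi'
        simp [hi'.symm]
      · simp
    rw [← h2 z, ← h2 0]
    exact h1 z
  have hfd : ∀ z, fderiv ℂ F z = fderiv ℂ F 0 := fun z => by
    refine ContinuousLinearMap.coe_injective
      ((EuclideanSpace.basisFun (Fin d) ℂ).toBasis.ext fun i => ?_)
    ext j
    simpa [D] using hDconst z i j
  have hlin : ∀ z, F z = fderiv ℂ F 0 z + F 0 := fun z => by
    have h1 : Differentiable ℂ fun z => F z - fderiv ℂ F 0 z :=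
      hF.sub (ContinuousLinearMap.differentiable _)
    have h2 := is_const_of_fderiv_eq_zero (𝕜 := ℂ) h1 (fun z => by
      have := ((hF z).hasFDerivAt.sub (fderiv ℂ F 0).hasFDerivAt).fderiv
      refine this.trans ?_
      rw [hfd, sub_self]) z 0
    simp only [map_zero, sub_zero] at h2
    rw [← h2]
    abel
  -- `F` is real on `U`, so real parts of the complex coefficients suffice.
  refine ⟨Matrix.of fun j i => (D 0 j i).re, WithLp.toLp 2 fun j => (F 0 j).re, fun x => ?_⟩
  have h1 := (hFf x).symm.trans (hlin _)
  have h2 : realToComplex (x : EuclideanSpace ℝ (Fin d)) =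
      ∑ i, ((x : EuclideanSpace ℝ (Fin d)) i : ℂ) • EuclideanSpace.single i (1 : ℂ) := by
    ext j
    simp [realToComplex, Pi.single_apply]
  ext j
  have h3 := congrArg (fun y : EuclideanSpace ℂ (Fin d) => (y j).re) h1
  rw [h2, map_sum] at h3
  simp only [map_smul] at h3
  simp [realToComplex] at h3
  simp [Matrix.toLpLin_apply, Matrix.mulVec, dotProduct, h3, D]
  refine Finset.sum_congr rfl fun i _ => mul_comm _ _

/-- The bound is given only for frequencies in `U`. Continuation makes `K` act on all real
frequencies, and sums of these are enough to compare measures. -/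
theorem ExpBounded.mem_dilationSet {w : EuclideanSpace ℝ (Fin d) → ℂ} (hw : Measurable w)
    (hpos : ∀ᵐ ξ, 0 ≤ w ξ)
    (hμ : ExpIntegrable (weightMeasure w) fun _ => 1) (hμ0 : weightMeasure w ≠ 0)
    {U : Set (EuclideanSpace ℝ (Fin d))} (hU : IsOpen U) (hne : U.Nonempty)
    {A : Matrix (Fin d) (Fin d) ℝ} {b : EuclideanSpace ℝ (Fin d)}
    (h : ExpBounded hμ U (affineExt A b)) : A ∈ dilationSet w := by
  have hfin : IsFiniteMeasure (weightMeasure w) := by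
    have := hμ.integrable
    rw [integrable_const_iff] at this
    exact this.resolve_left one_ne_zero
  obtain ⟨K, hK⟩ := h.exists_clm
  have hF : Differentiable ℂ (affineExt A b) :=
    (ContinuousLinearMap.differentiable _).add_const _
  have hK1 := hK _ _ (intertwines_one hF hU hne)
  have hm := (continuous_toEuclideanLin A.transpose).measurable
  have : IsFiniteMeasure ((weightMeasure w).map (Matrix.toEuclideanLin A.transpose)) :=
    Measure.isFiniteMeasure_map _ _
  have hle := measure_le_of_eLpNorm_expSum_le (weightMeasure w)
    ((weightMeasure w).map (Matrix.toEuclideanLin A.transpose)) (ENNReal.ofReal ‖K‖)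
    ENNReal.ofReal_ne_top fun c => by
      have h1 : Finsupp.linearCombination ℂ
          (fun x => expPoly hμ (affineExt A b (realToComplex x)) 1) c =
          K (Finsupp.linearCombination ℂ (fun x => expPoly hμ (realToComplex x) 1) c) := by
        simp [Finsupp.linearCombination_apply, Finsupp.sum, map_sum, hK1]
      have h2 := K.le_opNorm
        (Finsupp.linearCombination ℂ (fun x => expPoly hμ (realToComplex x) 1) c)
      rw [← h1, norm_linearCombination_expPoly, norm_linearCombination_expPoly] at h2
      simp only [affineExt_realToComplex] at h2
      have h3 := (memLp_expSum (weightMeasure w)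
        (fun x => Matrix.toEuclideanLin A x + b) c).2.ne
      have h4 := (memLp_expSum (weightMeasure w) (fun x => x) c).2.ne
      rw [← ENNReal.toReal_ofReal (norm_nonneg K), ← ENNReal.toReal_mul,
        ENNReal.toReal_le_toReal h3 (ENNReal.mul_ne_top ENNReal.ofReal_ne_top h4),
        eLpNorm_expSum_affine] at h2
      exact h2
  exact mem_dilationSet_of_map_weightMeasure_le hw hpos hμ0
    (ENNReal.pow_ne_top ENNReal.ofReal_ne_top) hle

end Affine

/-! ### The composition operator on `H_k` -/

section Main
variable {d : ℕ}

theorem expIntegrable_one_weightMeasure {w : EuclideanSpace ℝ (Fin d) → ℂ} (hw : Measurable w)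
    {n : ℕ} (hA : ∀ a : ℝ, 0 < a → DecayCondition w n a) :
    ExpIntegrable (weightMeasure w) fun _ => 1 := by
  intro c
  have hm := measurable_ofReal_re hw
  have hc : Continuous fun ξ : EuclideanSpace ℝ (Fin d) => (Real.exp (c * ‖ξ‖) : ℂ) * 1 := by
    fun_prop
  rw [weightMeasure, integrable_withDensity_iff_integrable_smul' hm (by simp)]
  -- With this `a` the decay is `exp(-(|c| + d + 1)‖ξ‖)`: `|c|` offsets the given exponential and `d
  -- + 1` leaves an integrable tail.
  have ha : 0 < (|c| + (d + 1)) / (4 * Real.pi) := by positivity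
  obtain ⟨L, hL, hdec⟩ := hA _ ha 1 one_pos
  have hint : Integrable fun ξ : EuclideanSpace ℝ (Fin d) => L * (1 + ‖ξ‖) ^ (-((d : ℝ) + 1)) :=
    (integrable_one_add_norm (by simp)).const_mul L
  refine hint.mono' (hm.ennreal_toReal.aestronglyMeasurable.smul hc.aestronglyMeasurable) ?_
  filter_upwards [hdec] with ξ hξ
  have h1 : (ENNReal.ofReal (w ξ).re).toReal ≤ ‖w ξ‖ := by
    rw [ENNReal.toReal_ofReal']
    exact max_le (Complex.re_le_norm _) (norm_nonneg _)
  have h2 : (1 + ‖ξ‖ ^ (2 * (n : ℝ) + (d : ℝ) + 1))⁻¹ ≤ 1 :=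
    inv_le_one_of_one_le₀ (le_add_of_nonneg_right (by positivity))
  rw [norm_smul, mul_one, Complex.norm_real, Real.norm_eq_abs,
    abs_of_nonneg ENNReal.toReal_nonneg, Real.norm_eq_abs, Real.abs_exp]
  have h3 : ‖w ξ‖ ≤ L * Real.exp (-(|c| + (d + 1)) * ‖ξ‖) := by
    refine hξ.trans ?_
    have : -4 * Real.pi * ((|c| + (d + 1)) / (4 * Real.pi)) * ‖ξ‖ = -(|c| + (d + 1)) * ‖ξ‖ := by
      field_simp
    rw [this]
    gcongr
    exact mul_le_of_le_one_right hL.le h2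
  calc _ ≤ (L * Real.exp (-(|c| + (d + 1)) * ‖ξ‖)) * Real.exp (|c| * ‖ξ‖) := by
        gcongr
        · exact h1.trans h3
        · exact le_abs_self c
    _ = L * Real.exp (‖ξ‖ * -((d : ℝ) + 1)) := by
        rw [mul_assoc, ← Real.exp_add]
        ring_nf
    _ = L * Real.exp ‖ξ‖ ^ (-((d : ℝ) + 1)) := by rw [Real.exp_mul]
    _ ≤ L * (1 + ‖ξ‖) ^ (-((d : ℝ) + 1)) := by
        refine mul_le_mul_of_nonneg_left ?_ hL.le
        refine Real.rpow_le_rpow_of_nonpos (by positivity) ?_ (by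
          have : (0 : ℝ) ≤ d := Nat.cast_nonneg d
          linarith)
        linarith [Real.add_one_le_exp ‖ξ‖]

theorem weightedNorm_eq_eLpNorm {w : EuclideanSpace ℝ (Fin d) → ℂ} (hw : Measurable w)
    {h : EuclideanSpace ℝ (Fin d) → ℂ} (hh : Continuous h) :
    weightedNorm w h = eLpNorm h 2 (weightMeasure w) := by
  rw [weightedNorm, eLpNorm_eq_lintegral_rpow_enorm_toReal (by simp) (by simp), weightMeasure,
    lintegral_withDensity_eq_lintegral_mul _ (measurable_ofReal_re hw)
      (hh.enorm.measurable.pow_const _)]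
  simp only [ENNReal.toReal_ofNat, Pi.mul_apply, mul_comm]
  norm_cast

theorem GrowthCondition.exists_norm_expPoly_le {w : EuclideanSpace ℝ (Fin d) → ℂ}
    (hw : Measurable w) (hB : GrowthCondition w)
    (hμ : ExpIntegrable (weightMeasure w) fun _ => 1) :
    ∃ M : ℝ, 0 < M ∧ ∀ z, ∀ᶠ m : ℕ in atTop, ∀ P : MvPolynomial (Fin d) ℂ, P.totalDegree ≤ m →
      ‖expPoly hμ z P‖ ≤ M ^ m * ‖expPoly hμ 0 P‖ := by
  obtain ⟨M, hM1, hM2⟩ := ENNReal.lt_iff_exists_nnreal_btwn.1 hB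
  have hMpos : 0 < M := by
    have := pos_of_gt hM1
    exact_mod_cast this
  refine ⟨M, hMpos, fun z => ?_⟩
  have h1 : limsup (fun m : ℕ => polyGrowth w z m ^ (1 / (m : ℝ))) atTop < M :=
    (le_iSup (fun z => limsup (fun m : ℕ => polyGrowth w z m ^ (1 / (m : ℝ))) atTop) z).trans_lt hM1
  filter_upwards [eventually_lt_of_limsup_lt h1, eventually_gt_atTop 0] with m hm hm0 P hP
  have hm0' : (m : ℝ) ≠ 0 := by positivity
  have h2 : polyGrowth w z m ≤ (M : ℝ≥0∞) ^ m := by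
    have := ENNReal.rpow_le_rpow hm.le (Nat.cast_nonneg (α := ℝ) m)
    rwa [← ENNReal.rpow_mul, one_div_mul_cancel hm0', ENNReal.rpow_one, ENNReal.rpow_natCast]
      at this
  rcases eq_or_ne P 0 with rfl | hP0
  · simp
  have h3 := (le_iSup (fun P : {P : MvPolynomial (Fin d) ℂ // P.totalDegree ≤ m ∧ P ≠ 0} =>
    weightedNorm w (mulExp z (polyFun P.1)) / weightedNorm w (polyFun P.1)) ⟨P, hP, hP0⟩).trans h2
  simp only at h3
  have hc : Continuous (mulExp z (polyFun P)) :=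
    (continuous_expFun z).mul (continuous_polyFun P)
  rw [weightedNorm_eq_eLpNorm hw hc, weightedNorm_eq_eLpNorm hw (continuous_polyFun P)] at h3
  have e0 : (fun ξ => expFun 0 ξ * polyFun P ξ) = polyFun P := by
    funext ξ
    rw [expFun_zero, one_mul]
  have h0 := hμ.memLp_expFun_mul_polyFun 0 P
  rw [e0] at h0
  rw [norm_expPoly, norm_expPoly, e0]
  have h4 : eLpNorm (mulExp z (polyFun P)) 2 (weightMeasure w) ≤
      (M : ℝ≥0∞) ^ m * eLpNorm (polyFun P) 2 (weightMeasure w) := by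
    -- The quotient says nothing about a vanishing denominator, but then `P` and `m_z P` both vanish
    -- almost everywhere.
    rcases eq_or_ne (eLpNorm (polyFun P) 2 (weightMeasure w)) 0 with hz | hz
    · have hz' := (eLpNorm_eq_zero_iff h0.1 (by simp)).1 hz
      have : mulExp z (polyFun P) =ᵐ[weightMeasure w] 0 := by
        filter_upwards [hz'] with ξ hξ
        simp [mulExp, hξ]
      rw [eLpNorm_congr_ae this]
      simp
    · exact (ENNReal.div_le_iff hz h0.2.ne).1 h3
  have h5 := ENNReal.toReal_mono (ENNReal.mul_ne_top (by simp) h0.2.ne) h4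
  rw [ENNReal.toReal_mul, ENNReal.toReal_pow, ENNReal.coe_toReal] at h5
  exact h5

/-- Both squared norms are the same quadratic form. The nodes `x i` and the frequencies `y i` are
kept apart so that this covers both `k` along `f` and the restriction of `k` to `U`. -/
theorem norm_linearCombination_point_eq (u : EuclideanSpace ℝ (Fin d) → ℂ) (hu_cont : Continuous u)
    (hu : MemLp u 2 volume) (hu_L1 : MemLp (fourierL2 u hu) 1 volume)
    (hpos : ∀ᵐ ξ, 0 ≤ fourierL2 u hu ξ) (hw : Measurable (fourierL2 u hu))
    (hμ : ExpIntegrable (weightMeasure (fourierL2 u hu)) fun _ => 1)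
    {X ι : Type*} {k : X → X → ℂ} (hk : IsPosDefKernel k)
    (x : ι → X) (y : ι → EuclideanSpace ℝ (Fin d)) (hxy : ∀ p q, k (x p) (x q) = u (y p - y q))
    (c : ι →₀ ℂ) :
    ‖Finsupp.linearCombination ℂ (fun i => KernelSpace.point hk (x i)) c‖ =
      ‖Finsupp.linearCombination ℂ (fun i => expPoly hμ (realToComplex (y i)) 1) c‖ := by
  have h1 := KernelSpace.norm_sq_linearCombination_point hk x c
  simp only [hxy] at h1
  rw [sum_conj_mul_eq_integral u hu_cont hu hu_L1] at h1
  have h2 := inner_self_eq_norm_sq_to_K (𝕜 := ℂ)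
    (Finsupp.linearCombination ℂ (fun i => expPoly hμ (realToComplex (y i)) 1) c)
  rw [L2.inner_def, integral_congr_ae (g := fun ξ =>
    ((‖expSum (fun i => realToComplex (y i)) c ξ‖ ^ 2 : ℝ) : ℂ)) (by
      filter_upwards [linearCombination_expPoly hμ (fun i => realToComplex (y i)) c] with ξ hξ
      rw [hξ, inner_self_eq_norm_sq_to_K]
      push_cast
      rfl)] at h2
  have hd := integral_withDensity_eq_integral_toReal_smul
    (measurable_ofReal_re hw) (μ := volume) (by simp)
    fun ξ => ((‖expSum (fun i => realToComplex (y i)) c ξ‖ ^ 2 : ℝ) : ℂ)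
  replace h2 := hd.symm.trans h2
  have h3 : ∫ ξ, ((‖expSum (fun i => realToComplex (y i)) c ξ‖ ^ 2 : ℝ) : ℂ) * fourierL2 u hu ξ =
      ∫ ξ, (ENNReal.ofReal (fourierL2 u hu ξ).re).toReal •
        ((‖expSum (fun i => realToComplex (y i)) c ξ‖ ^ 2 : ℝ) : ℂ) := by
    refine integral_congr_ae ?_
    filter_upwards [hpos] with ξ hξ
    obtain ⟨hr, hi⟩ := Complex.nonneg_iff.1 hξ
    rw [ENNReal.toReal_ofReal hr, Complex.real_smul, mul_comm]
    congr 1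
    exact Complex.ext rfl hi.symm
  rw [h3] at h1
  have h4 := h1.trans h2
  have h5 : ‖Finsupp.linearCombination ℂ (fun i => KernelSpace.point hk (x i)) c‖ ^ 2 =
      ‖Finsupp.linearCombination ℂ (fun i => expPoly hμ (realToComplex (y i)) 1) c‖ ^ 2 := by
    exact Complex.ofReal_injective (h4.trans (by push_cast; rfl))
  exact (sq_eq_sq₀ (norm_nonneg _) (norm_nonneg _)).1 h5

end Main

theorem mainTheorem2 (d n : ℕ) (hn : 0 < n)
    (u : EuclideanSpace ℝ (Fin d) → ℂ)
    (hu_cont : Continuous u) (hu : MemLp u 2 volume) (hu_ne : u ≠ 0)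
    (hu_pos : IsPosDefKernel fun x y => u (x - y))
    (hu_L1 : MemLp (fourierL2 u hu) 1 volume) (hu_Linf : MemLp (fourierL2 u hu) ⊤ volume)
    (hA : ∀ a : ℝ, 0 < a → DecayCondition (fourierL2 u hu) n a)
    (hB : GrowthCondition (fourierL2 u hu))
    (hC : Submodule.span ℝ (dilationSet (fourierL2 u hu)) = ⊤)
    (U : Set (EuclideanSpace ℝ (Fin d))) (hU : IsOpen U)
    (f : U → EuclideanSpace ℝ (Fin d))
    (F : EuclideanSpace ℂ (Fin d) → EuclideanSpace ℂ (Fin d)) (hF : Differentiable ℂ F)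
    (hFf : ∀ x : U, F (realToComplex (x : EuclideanSpace ℝ (Fin d))) = realToComplex (f x)) :
    (∃ A ∈ dilationSet (fourierL2 u hu), ∃ b : EuclideanSpace ℝ (Fin d),
        ∀ x : U, f x = Matrix.toEuclideanLin A (x : EuclideanSpace ℝ (Fin d)) + b) ↔
      ((kernelCompositionOperator u hu_pos U f).domain = ⊤ ∧
        ∃ C : ℝ, ∀ h : (kernelCompositionOperator u hu_pos U f).domain,
          ‖kernelCompositionOperator u hu_pos U f h‖ ≤ C * ‖h‖) := by
  have hw : Measurable (fourierL2 u hu) := (Lp.stronglyMeasurable _).measurable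
  have hpos : ∀ᵐ ξ, 0 ≤ fourierL2 u hu ξ :=
    ae_nonneg_of_integral_nonneg _ (memLp_one_iff_integrable.1 hu_L1) hw fun c => by
      have h1 := sum_conj_mul_eq_integral u hu_cont hu hu_L1 (fun x => x) c
      have h2 := hu_pos c c.support
      rw [h1] at h2
      exact h2
  have hμ := expIntegrable_one_weightMeasure hw hA
  -- Otherwise `û = 0` almost everywhere, and inversion gives `u = 0`.
  have hμ0 : weightMeasure (fourierL2 u hu) ≠ 0 := by
    intro h0
    rw [weightMeasure, withDensity_eq_zero_iff (measurable_ofReal_re hw).aemeasurable] at h0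
    refine hu_ne (funext fun x => ?_)
    have h1 := apply_sub_eq_integral u hu_cont hu hu_L1 x 0
    rw [sub_zero] at h1
    rw [h1, Pi.zero_apply]
    refine integral_eq_zero_of_ae ?_
    filter_upwards [h0, hpos] with ξ h2 h3
    obtain ⟨hr, hi⟩ := Complex.nonneg_iff.1 h3
    have h4 : (fourierL2 u hu ξ).re = 0 := le_antisymm (ENNReal.ofReal_eq_zero.1 h2) hr
    have h5 : fourierL2 u hu ξ = 0 := Complex.ext h4 hi.symm
    rw [h5, mul_zero, Pi.zero_apply]
  have hiff := KernelSpace.compositionOperator_bounded_iff hu_pos (hu_pos.restrict U) f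
  have hnorm1 := fun c : U →₀ ℂ => norm_linearCombination_point_eq u hu_cont hu hu_L1 hpos hw hμ
    hu_pos f f (fun _ _ => rfl) c
  have hnorm2 := fun c : U →₀ ℂ => norm_linearCombination_point_eq u hu_cont hu hu_L1 hpos hw hμ
    (hu_pos.restrict U) (fun x : U => x) (fun x : U => (x : EuclideanSpace ℝ (Fin d)))
    (fun _ _ => rfl) c
  have hmain : ((kernelCompositionOperator u hu_pos U f).domain = ⊤ ∧
      ∃ C : ℝ, ∀ h : (kernelCompositionOperator u hu_pos U f).domain,
        ‖kernelCompositionOperator u hu_pos U f h‖ ≤ C * ‖h‖) ↔ ExpBounded hμ U F := by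
    refine hiff.trans (exists_congr fun C => forall_congr' fun c => ?_)
    rw [hnorm1 c]
    simp only [hFf]
    rw [← hnorm2 c]
  rw [hmain]
  constructor
  · rintro ⟨A, hAd, b, hAb⟩
    obtain ⟨C, hCtop, hCle⟩ := exists_eLpNorm_expSum_affine_le hw hAd
    refine ⟨C.toReal, fun c => ?_⟩
    have hfin : IsFiniteMeasure (weightMeasure (fourierL2 u hu)) := by
      have := hμ.integrable
      rw [integrable_const_iff] at this
      exact this.resolve_left one_ne_zero
    rw [norm_linearCombination_expPoly, norm_linearCombination_expPoly, ← ENNReal.toReal_mul]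
    simp only [hFf, hAb]
    exact ENNReal.toReal_mono (ENNReal.mul_ne_top hCtop (memLp_expSum _ _ c).2.ne)
      (hCle U b (fun x => x) c)
  · intro hbd
    rcases U.eq_empty_or_nonempty with rfl | hne
    -- For empty `U` any matrix of `𝒢(u)` will do; the identity belongs to it with constant 1.
    · exact ⟨1, ⟨isUnit_one, 1, one_pos, Eventually.of_forall fun ξ => by simp⟩, 0,
        fun x => x.2.elim⟩
    · obtain ⟨M, hM, hgrow⟩ := hB.exists_norm_expPoly_le hw hμ
      obtain ⟨A, b, hAb⟩ := hbd.exists_eq_affine hw hμ hμ0 hM hgrow hC hU hne hF hFf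
      refine ⟨A, ExpBounded.mem_dilationSet hw hpos hμ hμ0 hU hne (b := b) ?_, b, hAb⟩
      obtain ⟨C, hCle⟩ := hbd
      refine ⟨C, fun c => ?_⟩
      simp only [affineExt_realToComplex, ← hAb, ← hFf]
      exact hCle c
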